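/- **Conventions.** All Hilbert spaces are complex. The anti-dual $\mathcal X^*$ of $\mathcal X$ is the space of continuous antilinear functionals on $\mathcal X$; the duality product $\langle x',x\rangle_{\mathcal X^*,\mathcal X}=x'(x)$ is linear in $x'$ and antilinear in $x$, and $\langle x,x'\rangle_{\mathcal X,\mathcal X^*}:=\overline{\langle x',x\rangle_{\mathcal X^*,\mathcal X}}$. The Riesz map is $\mathcal R_{\mathcal X}:\mathcal X\to\mathcal X^*$, $x\mapsto\langle x,\cdot\rangle_{\mathcal X}$. Let $\mathcal X,\mathcal U$ be Hilbert spaces. We identify $(\mathcal X^*\times\mathcal U)^*=\mathcal X\times\mathcal U^*$ and $(\mathcal X\times\mathcal U^*)^*=\mathcal X^*\times\mathcal U$. The adjoint $A^*:\mathcal Z^*\supset\operatorname{dom}A^*\to\mathcal Y^*$ of a densely defined $A:\mathcal Y\supset\operatorname{dom}A\to\mathcal Z$ is given by $A^*z'=y'$ iff $\langle z',Ay\rangle=\langle y',y\rangle$ for all $y\in\operatorname{dom}A$. A subspace $Z\subset\mathcal Y\times\mathcal Y^*$ is dissipative if $\operatorname{Re}\langle v,w\rangle_{\mathcal Y,\mathcal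 Y^*}\le 0$ for all $(v,w)\in Z$, and maximal dissipative if it is moreover not properly contained in another dissipative subspace; an operator $\mathcal Y\supset\operatorname{dom}A\to\mathcal Y^*$ is called so if its graph is. For $A:\mathcal X\supset\operatorname{dom}A\to\mathcal X$, $\rho(A)$ is the set of $\alpha\in\mathbb C$ such that $\alpha I-A$ has an inverse in $L(\mathcal X)$. A *dissipation node* on $(\mathcal X,\mathcal U)$ is a linear operator $M=\begin{bmatrix}F\&G\\K\&L\end{bmatrix}:\mathcal X^*\times\mathcal U\supset\operatorname{dom}M\to\mathcal X\times\mathcal U^*$ such that (a) $M$ is closed and dissipative; (b) $F\&G:=P_{\mathcal X}M$, with domain $\operatorname{dom}M$, is closed; (c) for every $u\in\mathcal U$ there is $x'\in\mathcal X^*$ with $(x',u)\in\operatorname{dom}M$; (d) for the *main operator* $F:\mathcal X^*\supset\operatorname{dom}F\to\mathcal X$, $\operatorname{dom}F=\{x':(x',0)\in\operatorname{dom}M\}$, $Fx'=F\&G\,(x',0)$, there is $\lambda$ with $\operatorname{Re}\lambda>0$ such that $\lambda\mathcal R_{\mathcal X}^{-1}-F$ has dense range. Put $Kx'=K\&L\,(x',0)$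 for $x'\in\operatorname{dom}F$. For $\beta\in\rho(F\mathcal R_{\mathcal X})$ let $\mathcal X_{-1}$ be the completion of $\mathcal X$ in the norm $\|(\beta\mathcal R_{\mathcal X}^{-1}-F)^{-1}x\|$, and let $F_{-1}:\mathcal X^*\to\mathcal X_{-1}$ and $[F_{-1}\ G]:\mathcal X^*\times\mathcal U\to\mathcal X_{-1}$ be the continuous extensions of $F$ and $F\&G$. For $\gamma\in\rho(F^*\mathcal R_{\mathcal X})$ let $\mathcal X^d_{-1}$ and $F^*_{-1}:\mathcal X^*\to\mathcal X^d_{-1}$ be obtained in the same way from $F^*$ and $\gamma$. The duality product of $\mathcal X$ and $\mathcal X^*$ extends continuously to $\mathcal X_{-1}\times\operatorname{dom}F^*$ and $\mathcal X^d_{-1}\times\operatorname{dom}F$; with respect to these extensions $G^*:\operatorname{dom}F^*\to\mathcal U^*$ and $K^*:\mathcal U\to\mathcal X^d_{-1}$ are the adjoints of $G:\mathcal U\to\mathcal X_{-1}$ and $K:\operatorname{dom}F\to\mathcal U^*$. Finally, $\mathcal F$ is the transfer function of the operator node $N=M\begin{bmatrix}\mathcal R_{\mathcal X}&0\\0&I\end{bmatrix}=\begin{bmatrix}A\&B\\C\&D\end{bmatrix}$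 with main operator $A=F\mathcal R_{\mathcal X}$, that is, $\mathcal F(\alpha)=C\&D\begin{bmatrix}(\alpha I-A_{-1})^{-1}B\\I\end{bmatrix}\in L(\mathcal U,\mathcal U^*)$ for $\alpha\in\rho(A)$, where $[A_{-1}\ B]$ is the continuous extension of $A\&B$ to $\mathcal X\times\mathcal U$ with values in the completion of $\mathcal X$ in the norm $\|(\beta I-A)^{-1}x\|$. **Proposition.** Let $M=\begin{bmatrix}F\&G\\K\&L\end{bmatrix}$ be a dissipation node on $(\mathcal X,\mathcal U)$. Then: (a) $M$ is maximal dissipative. (b) $M$ and $F$ are densely defined, and $\rho(F\mathcal R_{\mathcal X})$ and $\rho(F^*\mathcal R_{\mathcal X})$ contain the open right half-plane, so that the objects above are defined. The adjoint $M^*:\mathcal X^*\times\mathcal U\supset\operatorname{dom}M^*\to\mathcal X\times\mathcal U^*$ is a dissipation node on $(\mathcal X,\mathcal U)$. For every choice of $\beta\in\rho(F\mathcal R_{\mathcal X})$ and $\gamma\in\rho(F^*\mathcal R_{\mathcal X})$, $$M^*=\begin{bmatrix}[F\&G]^d\\ [K\&L]^d\end{bmatrix},\qquad \operatorname{dom}M^*=\{(x',y)\in\mathcal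 X^*\times\mathcal U:\ F^*_{-1}x'+K^*y\in\mathcal X\},$$ where $[F\&G]^d$ is the restriction of $[F^*_{-1}\ K^*]$ to $\operatorname{dom}M^*$ and, for every $\alpha\in\rho(F\mathcal R_{\mathcal X})$ and $(x',y)\in\operatorname{dom}M^*$, one has $x'-(\overline\alpha\mathcal R_{\mathcal X}^{-1}-F^*_{-1})^{-1}K^*y\in\operatorname{dom}F^*$ and $$[K\&L]^d\begin{pmatrix}x'\\y\end{pmatrix}=G^*\Big(x'-(\overline\alpha\mathcal R_{\mathcal X}^{-1}-F^*_{-1})^{-1}K^*y\Big)+\mathcal F(\alpha)^*y .$$ In particular, the main operator of $M^*$ is $F^*$. -/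

import Mathlib

open scoped ComplexConjugate

noncomputable section

namespace DissNode

/-! ### Anti-duals, Riesz map, canonical identifications -/

/-- The anti-dual: continuous antilinear functionals, with the operator norm.
The duality product `⟨x', x⟩` is `x' x`; it is linear in `x'` and antilinear in `x`. -/
abbrev AntiDual (E : Type*) [NormedAddCommGroup E] [NormedSpace ℂ E] : Type _ := E →L⋆[ℂ] ℂ

/-- The Riesz map `x ↦ ⟨x, ·⟩`, a linear isometric isomorphism onto the anti-dual.
(Mathlib's inner product is antilinear in its first argument, so `riesz X x y = inner ℂ y x`.) -/
def riesz (X : Type*) [NormedAddCommGroup X] [InnerProductSpace ℂ X] [CompleteSpace X] :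
    X ≃ₗᵢ[ℂ] AntiDual X :=
  LinearIsometryEquiv.ofSurjective
    { toLinearMap := ((innerSL ℂ (E := X)).flip : X →L[ℂ] AntiDual X).toLinearMap
      norm_map' := fun x => by
        refine le_antisymm (ContinuousLinearMap.opNorm_le_bound _ (norm_nonneg _) fun y => ?_) ?_
        · simpa [mul_comm] using norm_inner_le_norm (𝕜 := ℂ) y x
        · rcases eq_or_ne x 0 with rfl | hx
          · simp
          · have h := ((innerSL ℂ (E := X)).flip x).le_opNorm x
            have h2 : ‖((innerSL ℂ (E := X)).flip x) x‖ = ‖x‖ * ‖x‖ := by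
              simp [inner_self_eq_norm_sq_to_K, sq]
            rw [h2] at h
            exact le_of_mul_le_mul_right h (norm_pos_iff.mpr hx) }
    (fun f => by
      let g : X →L[ℂ] ℂ := ((starL ℂ : ℂ ≃L⋆[ℂ] ℂ) : ℂ →L⋆[ℂ] ℂ).comp f
      refine ⟨(InnerProductSpace.toDual ℂ X).symm g, ?_⟩
      ext y
      have h : inner ℂ ((InnerProductSpace.toDual ℂ X).symm g) y = g y := by simp
      change inner ℂ y ((InnerProductSpace.toDual ℂ X).symm g) = f y
      rw [← inner_conj_symm, h]
      simp [g])

theorem riesz_apply {X : Type*} [NormedAddCommGroup X] [InnerProductSpace ℂ X] [CompleteSpace X]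
    (x y : X) : riesz X x y = inner ℂ y x := rfl

section General

variable {E E' G G' V X Y U : Type*}
variable [NormedAddCommGroup E] [NormedSpace ℂ E] [NormedAddCommGroup G] [NormedSpace ℂ G]
variable [AddCommGroup E'] [Module ℂ E'] [AddCommGroup G'] [Module ℂ G']
variable [NormedAddCommGroup V] [NormedSpace ℂ V] [NormedAddCommGroup X] [NormedSpace ℂ X]
variable [NormedAddCommGroup Y] [NormedSpace ℂ Y] [NormedAddCommGroup U] [NormedSpace ℂ U]

/-- The complex conjugate of a continuous linear functional, as an element of the anti-dual. -/
def conjFunctional (f : E →L[ℂ] ℂ) : AntiDual E :=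
  ((starL ℂ : ℂ ≃L⋆[ℂ] ℂ) : ℂ →L⋆[ℂ] ℂ).comp f

/-- The canonical map `E → E**`, `⟨z, x'⟩ = conj ⟨x', z⟩`. -/
def bidual (E : Type*) [NormedAddCommGroup E] [NormedSpace ℂ E] :
    E →ₗ[ℂ] AntiDual (AntiDual E) where
  toFun z := conjFunctional (ContinuousLinearMap.apply' ℂ (starRingEnd ℂ) z)
  map_add' a b := by ext f; simp [conjFunctional]
  map_smul' c a := by ext f; simp [conjFunctional]

theorem bidual_apply (z : E) (x' : AntiDual E) : bidual E z x' = conj (x' z) := by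
  simp [bidual, conjFunctional]

/-- If `E'` and `G'` are identified with the anti-duals of `E` and `G`, then `E' × G'` is
identified with the anti-dual of `E × G`. -/
def prodDual (i : E' →ₗ[ℂ] AntiDual E) (j : G' →ₗ[ℂ] AntiDual G) :
    E' × G' →ₗ[ℂ] AntiDual (E × G) where
  toFun p := (i p.1).comp (ContinuousLinearMap.fst ℂ E G) +
    (j p.2).comp (ContinuousLinearMap.snd ℂ E G)
  map_add' p q := by ext z; simp; ring
  map_smul' c p := by ext z; simp

/-! ### Adjoints and dissipativity -/

/-- The graph of the adjoint of `A : E ⊇ dom A → G`: the pairs `(y', z')` such that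
`⟨y', A x⟩ = ⟨z', x⟩` for all `x ∈ dom A`, where `G'` and `E'` are identified with the
anti-duals of `G` and `E` through `j` and `i`. -/
def adjointGraph (j : G' →ₗ[ℂ] AntiDual G) (i : E' →ₗ[ℂ] AntiDual E) (A : E →ₗ.[ℂ] G) :
    Submodule ℂ (G' × E') where
  carrier := {p | ∀ x : A.domain, j p.1 (A x) = i p.2 (x : E)}
  zero_mem' := by intro x; simp
  add_mem' := by intro p q hp hq x; simp [hp x, hq x]
  smul_mem' := by intro c p hp x; simp [hp x]

/-- The adjoint `A* : G' ⊇ dom A* → E'` of a densely defined operator `A : E ⊇ dom A → G`. -/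
def adjointVia (j : G' →ₗ[ℂ] AntiDual G) (i : E' →ₗ[ℂ] AntiDual E) (A : E →ₗ.[ℂ] G) :
    G' →ₗ.[ℂ] E' :=
  (adjointGraph j i A).toLinearPMap

/-- Dissipative subspaces of `E × E'`, with `E'` identified with the anti-dual of `E` by `i`. -/
def IsDissipative (i : E' →ₗ[ℂ] AntiDual E) (Z : Submodule ℂ (E × E')) : Prop :=
  ∀ z ∈ Z, (i z.2 z.1).re ≤ 0

/-- Maximal dissipative subspaces: dissipative, and not properly contained in a dissipative
subspace. -/
def IsMaximalDissipative (i : E' →ₗ[ℂ] AntiDual E) (Z : Submodule ℂ (E × E')) : Prop :=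
  IsDissipative i Z ∧ ∀ Z' : Submodule ℂ (E × E'), IsDissipative i Z' → Z ≤ Z' → Z' = Z

/-! ### Block operators -/

/-- `A ∘ T` with its natural domain `{x | T x ∈ dom A}`. -/
def precomp (A : E →ₗ.[ℂ] Y) (T : V →ₗ[ℂ] E) : V →ₗ.[ℂ] Y where
  domain := A.domain.comap T
  toFun := A.toFun.comp (T.restrict (p := A.domain.comap T) (q := A.domain) fun _ h => h)

/-- The upper row (`F&G`, respectively `A&B`) of a block operator. -/
def topRow (S : V × U →ₗ.[ℂ] X × Y) : V × U →ₗ.[ℂ] X := (LinearMap.fst ℂ X Y).compPMap S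

/-- The lower row (`K&L`, respectively `C&D`) of a block operator. -/
def bottomRow (S : V × U →ₗ.[ℂ] X × Y) : V × U →ₗ.[ℂ] Y := (LinearMap.snd ℂ X Y).compPMap S

/-- The main operator: `x ↦ P_X S (x, 0)` with domain `{x | (x, 0) ∈ dom S}`. -/
def mainOp (S : V × U →ₗ.[ℂ] X × Y) : V →ₗ.[ℂ] X := precomp (topRow S) (LinearMap.inl ℂ V U)

/-- The operator `K` (respectively `C`): `x ↦ P_Y S (x, 0)`, on the domain of the main operator. -/
def outOp (S : V × U →ₗ.[ℂ] X × Y) : V →ₗ.[ℂ] Y := precomp (bottomRow S) (LinearMap.inl ℂ V U)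

/-! ### Resolvents and extrapolation spaces

Everything is done for operators `A : V ⊇ dom A → X` and the pencil `α J - A`, where `J : V ≃ X`
is an isomorphism. The choice `V = X`, `J = I` is the usual setting; dissipation nodes use
`V = X*` and `J` the inverse Riesz map. -/

/-- `α J - A`, with domain `dom A`. -/
def pencil (J : V ≃L[ℂ] X) (A : V →ₗ.[ℂ] X) (α : ℂ) : V →ₗ.[ℂ] X where
  domain := A.domain
  toFun := α • (J : V →ₗ[ℂ] X).comp A.domain.subtype - A.toFun

/-- `T` is an everywhere defined bounded two-sided inverse of `A`. -/
def IsBoundedInverse (A : V →ₗ.[ℂ] X) (T : X →L[ℂ] V) : Prop :=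
  (∀ x : A.domain, T (A x) = x) ∧ ∀ y : X, ∃ h : T y ∈ A.domain, A ⟨T y, h⟩ = y

/-- The resolvent set of `A : X ⊇ dom A → X`. -/
def resolventSet (A : X →ₗ.[ℂ] X) : Set ℂ :=
  {α | ∃ T : X →L[ℂ] X, IsBoundedInverse (pencil (ContinuousLinearEquiv.refl ℂ X) A α) T}

open scoped Classical in
/-- The bounded inverse of `A`, if it exists. -/
def boundedInverse (A : V →ₗ.[ℂ] X) : X →L[ℂ] V :=
  if h : ∃ T, IsBoundedInverse A T then h.choose else 0

/-- The space `X`, to be equipped with the norm `‖T x‖`. -/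
@[nolint unusedArguments]
def PreExtrap (_T : X →L[ℂ] V) : Type _ := X

instance (T : X →L[ℂ] V) : AddCommGroup (PreExtrap T) := inferInstanceAs (AddCommGroup X)

instance (T : X →L[ℂ] V) : Module ℂ (PreExtrap T) := inferInstanceAs (Module ℂ X)

/-- The identity of `X`, as a map to the renormed space. -/
def toPreExtrap (T : X →L[ℂ] V) : X →ₗ[ℂ] PreExtrap T := (LinearMap.id : X →ₗ[ℂ] X)

/-- `T` as a linear map on the renormed space. -/
def preExtrapMap (T : X →L[ℂ] V) : PreExtrap T →ₗ[ℂ] V := T.toLinearMap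

instance (T : X →L[ℂ] V) : SeminormedAddCommGroup (PreExtrap T) :=
  SeminormedAddCommGroup.induced _ V (preExtrapMap T)

instance (T : X →L[ℂ] V) : NormedSpace ℂ (PreExtrap T) := NormedSpace.induced ℂ _ V (preExtrapMap T)

theorem norm_toPreExtrap (T : X →L[ℂ] V) (x : X) : ‖toPreExtrap T x‖ = ‖T x‖ := rfl

/-- The extrapolation space: the completion of `X` with respect to the norm
`‖(β J - A)⁻¹ x‖`. -/
abbrev Extrap (J : V ≃L[ℂ] X) (A : V →ₗ.[ℂ] X) (β : ℂ) : Type _ :=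
  UniformSpace.Completion (PreExtrap (boundedInverse (pencil J A β)))

/-- The canonical embedding of `X` into the extrapolation space. -/
def toExtrap (J : V ≃L[ℂ] X) (A : V →ₗ.[ℂ] X) (β : ℂ) : X →L[ℂ] Extrap J A β :=
  LinearMap.mkContinuous
    ((UniformSpace.Completion.toComplL (𝕜 := ℂ)
      (E := PreExtrap (boundedInverse (pencil J A β)))).toLinearMap.comp (toPreExtrap _))
    ‖boundedInverse (pencil J A β)‖
    (fun x => (UniformSpace.Completion.norm_coe (toPreExtrap _ x)).trans_le
        ((boundedInverse (pencil J A β)).le_opNorm x))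

theorem norm_toExtrap (J : V ≃L[ℂ] X) (A : V →ₗ.[ℂ] X) (β : ℂ) (x : X) :
    ‖toExtrap J A β x‖ = ‖boundedInverse (pencil J A β) x‖ :=
  UniformSpace.Completion.norm_coe (toPreExtrap _ x)

/-- The extrapolated operator `A₋₁ : V → X₋₁`, the continuous extension of `A`. -/
def extrapOp (J : V ≃L[ℂ] X) (A : V →ₗ.[ℂ] X) (β : ℂ) : V →L[ℂ] Extrap J A β :=
  ((toExtrap J A β).toLinearMap.comp A.toFun).extendOfNorm A.domain.subtype

/-- `(α J - A₋₁)⁻¹ : X₋₁ → V`. -/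
def extrapResolvent (J : V ≃L[ℂ] X) (A : V →ₗ.[ℂ] X) (β α : ℂ) : Extrap J A β →L[ℂ] V :=
  (α • (toExtrap J A β).comp (J : V →L[ℂ] X) - extrapOp J A β).inverse

/-- The continuous extension `[A₋₁ B] : V × U → X₋₁` of the upper row `A&B` of `S`. -/
def extrapRow (J : V ≃L[ℂ] X) (S : V × U →ₗ.[ℂ] X × Y) (β : ℂ) :
    V × U →L[ℂ] Extrap J (mainOp S) β :=
  ((toExtrap J (mainOp S) β).toLinearMap.comp (topRow S).toFun).extendOfNorm S.domain.subtype

/-- The control operator `B : U → X₋₁` (called `G` for dissipation nodes). -/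
def controlOp (J : V ≃L[ℂ] X) (S : V × U →ₗ.[ℂ] X × Y) (β : ℂ) :
    U →L[ℂ] Extrap J (mainOp S) β :=
  (extrapRow J S β).comp (ContinuousLinearMap.inr ℂ V U)

open scoped Classical in
/-- The transfer function `s ↦ C&D ((s I - A₋₁)⁻¹ B, I)` of an operator node `S`, computed in
the extrapolation space that is built with `β`. -/
def transferFunction (S : X × U →ₗ.[ℂ] X × Y) (β s : ℂ) : U →L[ℂ] Y :=
  let J := ContinuousLinearEquiv.refl ℂ X
  if h : ∃ T : U →L[ℂ] Y, ∀ u, ∃ hu :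
      (extrapResolvent J (mainOp S) β s (controlOp J S β u), u) ∈ (bottomRow S).domain,
      T u = bottomRow S ⟨_, hu⟩
  then h.choose else 0

end General

/-! ### Dissipation nodes -/

section Node

variable {X U : Type*} [NormedAddCommGroup X] [InnerProductSpace ℂ X] [CompleteSpace X]
  [NormedAddCommGroup U] [InnerProductSpace ℂ U] [CompleteSpace U]

/-- The inverse Riesz map. -/
def rieszInv (X : Type*) [NormedAddCommGroup X] [InnerProductSpace ℂ X] [CompleteSpace X] :
    AntiDual X ≃L[ℂ] X :=
  (riesz X).symm.toContinuousLinearEquiv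

/-- The identification of `X × U*` with the anti-dual of `X* × U`. -/
def codomainDual (X U : Type*) [NormedAddCommGroup X] [InnerProductSpace ℂ X]
    [NormedAddCommGroup U] [InnerProductSpace ℂ U] :
    X × AntiDual U →ₗ[ℂ] AntiDual (AntiDual X × U) :=
  prodDual (bidual X) LinearMap.id

/-- The identification of `X* × U` with the anti-dual of `X × U*`. -/
def domainDual (X U : Type*) [NormedAddCommGroup X] [InnerProductSpace ℂ X]
    [NormedAddCommGroup U] [InnerProductSpace ℂ U] :
    AntiDual X × U →ₗ[ℂ] AntiDual (X × AntiDual U) :=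
  prodDual LinearMap.id (bidual U)

/-- Dissipation nodes on `(X, U)`. -/
structure IsDissipationNode (M : AntiDual X × U →ₗ.[ℂ] X × AntiDual U) : Prop where
  closed : M.IsClosed
  dissipative : IsDissipative (codomainDual X U) M.graph
  closed_topRow : (topRow M).IsClosed
  exists_mem_domain : ∀ u : U, ∃ x' : AntiDual X, (x', u) ∈ M.domain
  dense_range : ∃ l : ℂ, 0 < l.re ∧ DenseRange (pencil (rieszInv X) (mainOp M) l)

/-- The adjoint `M* : X* × U ⊇ dom M* → X × U*`. -/
def nodeAdjoint (M : AntiDual X × U →ₗ.[ℂ] X × AntiDual U) :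
    AntiDual X × U →ₗ.[ℂ] X × AntiDual U :=
  adjointVia (domainDual X U) (codomainDual X U) M

/-- The adjoint `F* : X* ⊇ dom F* → X` of `F : X* ⊇ dom F → X`. -/
def opAdjoint (F : AntiDual X →ₗ.[ℂ] X) : AntiDual X →ₗ.[ℂ] X :=
  adjointVia LinearMap.id (bidual X) F

/-- The operator `F R` on `X`, `R` the Riesz map. -/
def compRiesz (F : AntiDual X →ₗ.[ℂ] X) : X →ₗ.[ℂ] X :=
  precomp F (riesz X).toLinearEquiv.toLinearMap

/-- The operator `N = M (R ⊕ I)` on `X × U`. -/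
def nodeCompRiesz (M : AntiDual X × U →ₗ.[ℂ] X × AntiDual U) :
    X × U →ₗ.[ℂ] X × AntiDual U :=
  precomp M ((riesz X).toLinearEquiv.toLinearMap.prodMap LinearMap.id)

/-- The duality product `⟨ξ, x'⟩` of an element `ξ` of the extrapolation space of `A` with a
functional `x'` in the domain of the adjoint of `A`: the continuous extension of
`x ↦ ⟨x, x'⟩ = conj (x' x)` from `X` to the extrapolation space. -/
def extrapPairing (A : AntiDual X →ₗ.[ℂ] X) (β : ℂ) (x' : AntiDual X) :
    Extrap (rieszInv X) A β →L[ℂ] ℂ :=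
  (((starL ℂ : ℂ ≃L⋆[ℂ] ℂ) : ℂ →L⋆[ℂ] ℂ).comp x' : X →L[ℂ] ℂ).toLinearMap.extendOfNorm
    (toExtrap (rieszInv X) A β).toLinearMap

/-- `G* : dom F* → U*`, the adjoint of `G : U → X₋₁`, where `X₋₁` is the anti-dual of `dom F*`
by the duality product that extends the one of `X` and `X*`. -/
def controlAdjoint (M : AntiDual X × U →ₗ.[ℂ] X × AntiDual U) (β : ℂ)
    (x' : (opAdjoint (mainOp M)).domain) : AntiDual U :=
  conjFunctional ((extrapPairing (mainOp M) β x').comp (controlOp (rieszInv X) M β))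

open scoped Classical in
/-- `K* : U → (X₋₁ of F*)`, the adjoint of `K : dom F → U*`, where the extrapolation space of
`F*` is the anti-dual of `dom F`: `⟨K* v, x'⟩ = ⟨v, K x'⟩` for all `x' ∈ dom F`. -/
def outAdjoint (M : AntiDual X × U →ₗ.[ℂ] X × AntiDual U) (γ : ℂ) :
    U →L[ℂ] Extrap (rieszInv X) (opAdjoint (mainOp M)) γ :=
  if h : ∃ T : U →L[ℂ] Extrap (rieszInv X) (opAdjoint (mainOp M)) γ,
      ∀ (v : U) (x' : (outOp M).domain),
        extrapPairing (opAdjoint (mainOp M)) γ x' (T v) = conj (outOp M x' v)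
  then h.choose else 0

/-- The adjoint `T* : U → U*` of a bounded operator `T : U → U*`: `⟨T* y, u⟩ = ⟨y, T u⟩`. -/
def boundedAdjoint (T : U →L[ℂ] AntiDual U) (y : U) : AntiDual U := conjFunctional (T.flip y)

end Node

end DissNode

end

open scoped ComplexConjugate

noncomputable section

namespace DissNode

/-! ### Graphs of block operators, pencils and resolvents -/

section Graphs

variable {E V X Y U : Type*}
variable [NormedAddCommGroup E] [NormedSpace ℂ E]
variable [NormedAddCommGroup V] [NormedSpace ℂ V] [NormedAddCommGroup X] [NormedSpace ℂ X]
variable [NormedAddCommGroup Y] [NormedSpace ℂ Y] [NormedAddCommGroup U] [NormedSpace ℂ U]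

/-! Write `J` for the inverse Riesz map. Pairing `(λJ - F)p` with `p` gives `‖(λJ - F)p‖ ≥ Re λ
‖p‖`, because `F` is dissipative. As `F` is closed, dense range at one `λ` in the right half-plane
therefore yields a bounded inverse there. An orthogonality argument carries this to the whole
half-plane (`IsResolvent.exists_of_re_pos`) and also shows that `dom F` is dense.

Maximality uses surjectivity of `J - F`: an element of a dissipative extension can be corrected by
an element of `M` until the difference is `(w, 0; Jw, z)`. Dissipativity kills `w`, and then
condition (c) kills `z`. Dissipativity of `M*` follows: if `(v, w)` in its graph had `Re ⟨w, v⟩ >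
0`, adjoining `(v, -w)` to `M` would keep it dissipative, since the cross terms are purely
imaginary. Maximality would put `(v, -w)` in `M`, and the adjoint relation would force `Re ⟨w, v⟩ =
0`.

For the block form, fix `α ∈ ρ(FR)`. For each `q ∈ U` there is a unique `W q` with `F&G (W q, q) =
αJ(W q)`; it depends boundedly on `q`, and so does `D q = K&L (W q, q)` (`exists_controlResolvent`).
In the extrapolation space `W = (αJ - F₋₁)⁻¹G`, and `D` is the transfer function at `α`. Every
element of `M` over `q` is this solution plus an element over `0`, so the adjoint relation splits in
two. Over `0` it involves only `F` and `K` and says `x = F*₋₁x' + K*y`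
(`mem_graph_topRow_nodeAdjoint_iff`). On the solutions it determines the lower component
(`bottomRow_nodeAdjoint_eq`). -/

theorem mem_graph_precomp {A : E →ₗ.[ℂ] Y} {T : V →ₗ[ℂ] E} {v : V} {y : Y} :
    (v, y) ∈ (precomp A T).graph ↔ (T v, y) ∈ A.graph := by
  simp only [LinearPMap.mem_graph_iff]
  constructor
  · rintro ⟨⟨w, hw⟩, rfl, h⟩
    exact ⟨⟨T w, hw⟩, rfl, h⟩
  · rintro ⟨⟨w, hw⟩, h, h'⟩
    obtain rfl : w = T v := h
    exact ⟨⟨v, hw⟩, rfl, h'⟩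

theorem mem_graph_topRow {S : V × U →ₗ.[ℂ] X × Y} {p : V × U} {x : X} :
    (p, x) ∈ (topRow S).graph ↔ ∃ y, (p, (x, y)) ∈ S.graph := by
  simp only [LinearPMap.mem_graph_iff]
  constructor
  · rintro ⟨w, h, h'⟩
    exact ⟨(S w).2, w, h, Prod.ext h' rfl⟩
  · rintro ⟨y, w, h, h'⟩
    exact ⟨w, h, congrArg Prod.fst h'⟩

theorem mem_graph_bottomRow {S : V × U →ₗ.[ℂ] X × Y} {p : V × U} {y : Y} :
    (p, y) ∈ (bottomRow S).graph ↔ ∃ x, (p, (x, y)) ∈ S.graph := by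
  simp only [LinearPMap.mem_graph_iff]
  constructor
  · rintro ⟨w, h, h'⟩
    exact ⟨(S w).1, w, h, Prod.ext rfl h'⟩
  · rintro ⟨y, w, h, h'⟩
    exact ⟨w, h, congrArg Prod.snd h'⟩

theorem mem_graph_mainOp {S : V × U →ₗ.[ℂ] X × Y} {v : V} {x : X} :
    (v, x) ∈ (mainOp S).graph ↔ ∃ y, ((v, 0), (x, y)) ∈ S.graph :=
  mem_graph_precomp.trans mem_graph_topRow

theorem mem_graph_outOp {S : V × U →ₗ.[ℂ] X × Y} {v : V} {y : Y} :
    (v, y) ∈ (outOp S).graph ↔ ∃ x, ((v, 0), (x, y)) ∈ S.graph :=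
  mem_graph_precomp.trans mem_graph_bottomRow

theorem mem_graph_pencil {J : V ≃L[ℂ] X} {A : V →ₗ.[ℂ] X} {α : ℂ} {v : V} {x : X} :
    (v, x) ∈ (pencil J A α).graph ↔ (v, α • J v - x) ∈ A.graph := by
  simp only [LinearPMap.mem_graph_iff]
  constructor
  · rintro ⟨⟨w, hw⟩, rfl, rfl⟩
    exact ⟨⟨w, hw⟩, rfl, (sub_sub_cancel _ _).symm⟩
  · rintro ⟨⟨w, hw⟩, h, h'⟩
    obtain rfl : w = v := h
    refine ⟨⟨w, hw⟩, rfl, ?_⟩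
    change α • J w - A ⟨w, hw⟩ = x
    rw [h']
    exact sub_sub_cancel _ _

theorem isBoundedInverse_iff {A : V →ₗ.[ℂ] X} {T : X →L[ℂ] V} :
    IsBoundedInverse A T ↔ ∀ v x, (v, x) ∈ A.graph ↔ T x = v := by
  constructor
  · rintro ⟨h1, h2⟩ v x
    constructor
    · intro h
      obtain ⟨w, rfl, rfl⟩ := (LinearPMap.mem_graph_iff _).1 h
      exact h1 w
    · rintro rfl
      obtain ⟨h, h'⟩ := h2 x
      exact (LinearPMap.mem_graph_iff _).2 ⟨⟨_, h⟩, rfl, h'⟩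
  · intro h
    refine ⟨fun x => (h _ _).1 (A.mem_graph x), fun y => ?_⟩
    obtain ⟨w, hw, hAw⟩ := (LinearPMap.mem_graph_iff _).1 ((h (T y) y).2 rfl)
    have hw : (w : V) = T y := hw
    refine ⟨hw ▸ w.2, ?_⟩
    exact (congrArg A (Subtype.ext hw.symm)).trans hAw

/-- `T` is the bounded inverse of the pencil `α J - A`, in terms of the graph of `A`. -/
def IsResolvent (J : V ≃L[ℂ] X) (A : V →ₗ.[ℂ] X) (α : ℂ) (T : X →L[ℂ] V) : Prop :=
  ∀ v x, (v, x) ∈ A.graph ↔ T (α • J v - x) = v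

theorem isResolvent_iff {J : V ≃L[ℂ] X} {A : V →ₗ.[ℂ] X} {α : ℂ} {T : X →L[ℂ] V} :
    IsResolvent J A α T ↔ IsBoundedInverse (pencil J A α) T := by
  rw [isBoundedInverse_iff]
  simp only [mem_graph_pencil]
  constructor
  · intro h v x
    rw [h, sub_sub_cancel]
  · intro h v x
    rw [← h, sub_sub_cancel]

theorem IsResolvent.mem_graph {J : V ≃L[ℂ] X} {A : V →ₗ.[ℂ] X} {α : ℂ} {T : X →L[ℂ] V}
    (h : IsResolvent J A α T) (x : X) : (T x, α • J (T x) - x) ∈ A.graph := by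
  rw [h, sub_sub_cancel]

theorem IsResolvent.boundedInverse {J : V ≃L[ℂ] X} {A : V →ₗ.[ℂ] X} {β : ℂ} {T : X →L[ℂ] V}
    (h : IsResolvent J A β T) : IsResolvent J A β (boundedInverse (pencil J A β)) := by
  have h' : ∃ T, IsBoundedInverse (pencil J A β) T := ⟨T, isResolvent_iff.1 h⟩
  rw [isResolvent_iff, DissNode.boundedInverse, dif_pos h']
  exact h'.choose_spec

theorem mem_resolventSet_iff {A : X →ₗ.[ℂ] X} {α : ℂ} :
    α ∈ resolventSet A ↔ ∃ T, IsResolvent (ContinuousLinearEquiv.refl ℂ X) A α T := by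
  simp only [isResolvent_iff]
  rfl

/-! ### Extrapolation spaces -/

section Extrapolation

variable {J : V ≃L[ℂ] X} {A : V →ₗ.[ℂ] X} {α β : ℂ} {T T' : X →L[ℂ] V}

theorem denseRange_toExtrap (J : V ≃L[ℂ] X) (A : V →ₗ.[ℂ] X) (β : ℂ) :
    DenseRange (toExtrap J A β) :=
  UniformSpace.Completion.denseRange_coe
    (α := PreExtrap (DissNode.boundedInverse (pencil J A β)))

/-- The resolvent identity, which makes the extrapolation norms comparable for different points of
the resolvent set. -/
theorem IsResolvent.sub_eq (h : IsResolvent J A α T) (h' : IsResolvent J A β T') (x : X) :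
    T x = T' x + (β - α) • T (J (T' x)) := by
  have h1 := (h _ _).1 (h'.mem_graph x)
  have h2 : α • J (T' x) - (β • J (T' x) - x) = x - (β - α) • J (T' x) := by module
  rw [h2, map_sub, map_smul] at h1
  exact sub_eq_iff_eq_add.1 h1

theorem exists_norm_le_norm_toExtrap (h : IsResolvent J A α T) (h' : IsResolvent J A β T') :
    ∃ C, ∀ x, ‖T x‖ ≤ C * ‖toExtrap J A β x‖ := by
  refine ⟨1 + ‖β - α‖ * (‖T‖ * ‖(J : V →L[ℂ] X)‖), fun x => ?_⟩
  rw [norm_toExtrap, h.sub_eq h'.boundedInverse x]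
  set v := DissNode.boundedInverse (pencil J A β) x
  have h1 : ‖T (J v)‖ ≤ ‖T‖ * (‖(J : V →L[ℂ] X)‖ * ‖v‖) :=
    (T.le_opNorm _).trans (by gcongr; exact (J : V →L[ℂ] X).le_opNorm v)
  calc ‖v + (β - α) • T (J v)‖ ≤ ‖v‖ + ‖β - α‖ * ‖T (J v)‖ :=
        (norm_add_le _ _).trans (by rw [norm_smul])
    _ ≤ ‖v‖ + ‖β - α‖ * (‖T‖ * (‖(J : V →L[ℂ] X)‖ * ‖v‖)) := by gcongr
    _ = _ := by ring

theorem denseRange_subtype_domain {Z : Type*} [AddCommGroup Z] [Module ℂ Z] {B : V →ₗ.[ℂ] Z}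
    (hB : Dense (B.domain : Set V)) : DenseRange B.domain.subtype := by
  simpa [DenseRange] using hB

/-- On `dom A` one has `(βJ - A)⁻¹A = β(βJ - A)⁻¹J - 1`, so `A` is bounded into the extrapolation
norm. This bound is what makes the extension by density a true extension. -/
theorem extrapOp_apply (hA : Dense (A.domain : Set V)) (h : IsResolvent J A β T) {v : V} {x : X}
    (hvx : (v, x) ∈ A.graph) : extrapOp J A β v = toExtrap J A β x := by
  obtain ⟨w, hw, hw'⟩ := (LinearPMap.mem_graph_iff _).1 hvx
  obtain rfl : (w : V) = v := hw
  obtain rfl : A w = x := hw'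
  refine LinearMap.extendOfNorm_eq (denseRange_subtype_domain hA) ?_ w
  set T₀ := DissNode.boundedInverse (pencil J A β) with hT₀
  have h₀ : IsResolvent J A β T₀ := h.boundedInverse
  refine ⟨‖β‖ * (‖T₀‖ * ‖(J : V →L[ℂ] X)‖) + 1, fun w => ?_⟩
  change ‖toExtrap J A β (A w)‖ ≤ _ * ‖(w : V)‖
  have h1 := (h₀ _ _).1 (A.mem_graph w)
  rw [map_sub, map_smul, sub_eq_iff_eq_add, ← sub_eq_iff_eq_add'] at h1
  have h2 : ‖T₀ (J w)‖ ≤ ‖T₀‖ * (‖(J : V →L[ℂ] X)‖ * ‖(w : V)‖) :=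
    (T₀.le_opNorm _).trans (by gcongr; exact (J : V →L[ℂ] X).le_opNorm (w : V))
  rw [norm_toExtrap, ← hT₀, ← h1]
  calc ‖β • T₀ (J w) - (w : V)‖ ≤ ‖β‖ * ‖T₀ (J w)‖ + ‖(w : V)‖ :=
        (norm_sub_le _ _).trans (by rw [norm_smul])
    _ ≤ ‖β‖ * (‖T₀‖ * (‖(J : V →L[ℂ] X)‖ * ‖(w : V)‖)) + ‖(w : V)‖ := by gcongr
    _ = _ := by ring

/-- The resolvent of the extrapolated operator extends the resolvent, and inverts the
extrapolated pencil. -/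
theorem extrapResolvent_spec [CompleteSpace V] (hA : Dense (A.domain : Set V))
    (h : IsResolvent J A α T) (h' : IsResolvent J A β T') :
    (∀ x, extrapResolvent J A β α (toExtrap J A β x) = T x) ∧
    (∀ v, extrapResolvent J A β α (α • toExtrap J A β (J v) - extrapOp J A β v) = v) ∧
    ∀ ξ, α • toExtrap J A β (J (extrapResolvent J A β α ξ)) -
      extrapOp J A β (extrapResolvent J A β α ξ) = ξ := by
  obtain ⟨R, hR⟩ : ∃ R : Extrap J A β →L[ℂ] V, ∀ x, R (toExtrap J A β x) = T x :=
    ⟨T.toLinearMap.extendOfNorm (toExtrap J A β).toLinearMap, LinearMap.extendOfNorm_eq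
      (denseRange_toExtrap J A β) (exists_norm_le_norm_toExtrap h h')⟩
  obtain ⟨P, hP⟩ : ∃ P : V →L[ℂ] Extrap J A β,
      P = α • (toExtrap J A β).comp (J : V →L[ℂ] X) - extrapOp J A β := ⟨_, rfl⟩
  have hP' : ∀ v, P v = α • toExtrap J A β (J v) - extrapOp J A β v := fun v => by rw [hP]; rfl
  have hPA : ∀ v x, (v, x) ∈ A.graph → P v = toExtrap J A β (α • J v - x) := fun v x hvx => by
    rw [hP', extrapOp_apply hA h' hvx, map_sub, map_smul]
  have h1 : ∀ v, R (P v) = v := by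
    refine (denseRange_subtype_domain hA).induction ?_
      (isClosed_eq (R.continuous.comp P.continuous) continuous_id)
    rintro _ ⟨w, rfl⟩
    exact (congrArg R (hPA _ _ (A.mem_graph w))).trans
      ((hR _).trans ((h _ _).1 (A.mem_graph w)))
  have h2 : ∀ ξ, P (R ξ) = ξ := by
    refine (denseRange_toExtrap J A β).induction ?_
      (isClosed_eq (P.continuous.comp R.continuous) continuous_id)
    rintro _ ⟨x, rfl⟩
    rw [hR, hPA _ _ (h.mem_graph x), sub_sub_cancel]
  have h3 : extrapResolvent J A β α = R := by
    rw [extrapResolvent, ← hP]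
    exact ContinuousLinearMap.inverse_eq (ContinuousLinearMap.ext h2) (ContinuousLinearMap.ext h1)
  simp only [h3, ← hP']
  exact ⟨hR, h1, h2⟩

/-- The part of the extrapolated operator in `X` is the original operator. -/
theorem mem_graph_of_extrapOp_eq [CompleteSpace V] (hA : Dense (A.domain : Set V))
    (h : IsResolvent J A β T) {v : V} {x : X} (hvx : extrapOp J A β v = toExtrap J A β x) :
    (v, x) ∈ A.graph := by
  obtain ⟨h1, h2, -⟩ := extrapResolvent_spec hA h h
  rw [h, ← h1, map_sub, map_smul, ← hvx, h2]

end Extrapolation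

/-! ### Operator nodes -/

section OperatorNode

variable {J : V ≃L[ℂ] X} {S : V × U →ₗ.[ℂ] X × Y} {α β : ℂ} {T T' : X →L[ℂ] V}

theorem mainOp_sub_mem {v v' : V} {u : U} {x x' : X} {y y' : Y}
    (h : ((v, u), (x, y)) ∈ S.graph) (h' : ((v', u), (x', y')) ∈ S.graph) :
    (v - v', x - x') ∈ (mainOp S).graph := by
  refine mem_graph_mainOp.2 ⟨y - y', ?_⟩
  have := S.graph.sub_mem h h'
  simpa using this

theorem isClosed_mainOp (hS : (topRow S).IsClosed) : (mainOp S).IsClosed := by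
  have : ((mainOp S).graph : Set (V × X)) =
      (fun p : V × X => (((p.1, 0) : V × U), p.2)) ⁻¹' (topRow S).graph := by
    ext ⟨v, x⟩
    exact mem_graph_precomp
  rw [LinearPMap.IsClosed, this]
  exact IsClosed.preimage (by fun_prop) hS

/-- The fibre of `dom S` over each `u` is a translate of the domain of the main operator. -/
theorem dense_domain_of_mainOp (hS : ∀ u, ∃ v, (v, u) ∈ S.domain)
    (hd : Dense ((mainOp S).domain : Set V)) : Dense (S.domain : Set (V × U)) := by
  rintro ⟨v, u⟩
  obtain ⟨v₀, h₀⟩ := hS u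
  have hv : v - v₀ ∈ closure ((mainOp S).domain : Set V) := hd _
  have : Set.MapsTo (fun w : V => (w + v₀, u)) ((mainOp S).domain : Set V)
      (S.domain : Set (V × U)) := by
    intro w hw
    have hw : (w, 0) ∈ S.domain := hw
    simpa using S.domain.add_mem hw h₀
  simpa using map_mem_closure (f := fun w : V => (w + v₀, u)) (by fun_prop) hv this

/-- For `α` in the resolvent set, the equation `(v, u) ∈ dom S`, `A&B (v, u) = α J v` has a unique
solution `v` for every `u`; this solution and `C&D (v, u)` depend continuously on `u`. -/
theorem exists_controlResolvent [CompleteSpace V] [CompleteSpace U] [CompleteSpace Y]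
    (hS : S.IsClosed) (hU : ∀ u, ∃ v, (v, u) ∈ S.domain) (h : IsResolvent J (mainOp S) α T) :
    ∃ (W : U →L[ℂ] V) (D : U →L[ℂ] Y), ∀ u, ((W u, u), (α • J (W u), D u)) ∈ S.graph := by
  have huniq : ∀ {u : U} {p q : V × Y}, ((p.1, u), (α • J p.1, p.2)) ∈ S.graph →
      ((q.1, u), (α • J q.1, q.2)) ∈ S.graph → p = q := by
    rintro u ⟨v, y⟩ ⟨v', y'⟩ hp hq
    have h1 := (h _ _).1 (mainOp_sub_mem hp hq)
    simp only [map_sub, smul_sub, sub_self, map_zero] at h1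
    obtain rfl : v = v' := (sub_eq_zero.1 h1.symm)
    have h2 := S.mem_graph_snd_inj hp hq rfl
    exact Prod.ext rfl (congrArg Prod.snd h2 :)
  have hex : ∀ u : U, ∃ p : V × Y, ((p.1, u), (α • J p.1, p.2)) ∈ S.graph := by
    intro u
    obtain ⟨v₀, hv₀⟩ := hU u
    obtain ⟨⟨x₀, y₀⟩, h₀⟩ := LinearPMap.mem_domain_iff.1 hv₀
    obtain ⟨y, hy⟩ := mem_graph_mainOp.1 (h.mem_graph (x₀ - α • J v₀))
    -- Starting from any `(v₀, u)` in the domain, the resolvent corrects the defect `x₀ - αJv₀` by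
    -- an element over `0`.
    refine ⟨(T (x₀ - α • J v₀) + v₀, y + y₀), ?_⟩
    have := S.graph.add_mem hy h₀
    simp only [Prod.mk_add_mk, zero_add] at this
    convert this using 3
    simp only [map_add, smul_add]
    abel
  choose f hf using hex
  let g : U →ₗ[ℂ] V × Y :=
    { toFun := f
      map_add' := fun u u' => huniq (hf _) (by simpa using S.graph.add_mem (hf u) (hf u'))
      map_smul' := fun c u => huniq (hf _) (by
        simpa [smul_comm c α] using S.graph.smul_mem c (hf u)) }
  have hg : Continuous g := by
    -- Closed graph theorem: limits of solutions are solutions because `S` is closed, and solutions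
    -- are unique.
    refine g.continuous_of_seq_closed_graph fun s u p hs hp => ?_
    have hlim : Filter.Tendsto (fun n => (((g (s n)).1, s n), (α • J (g (s n)).1, (g (s n)).2)))
        Filter.atTop (nhds ((p.1, u), (α • J p.1, p.2))) := by
      have h1 : Filter.Tendsto (fun n => (g (s n)).1) Filter.atTop (nhds p.1) :=
        (continuous_fst.tendsto p).comp hp
      have h2 : Filter.Tendsto (fun n => (g (s n)).2) Filter.atTop (nhds p.2) :=
        (continuous_snd.tendsto p).comp hp
      exact (h1.prodMk_nhds hs).prodMk_nhds
        (((J.continuous.tendsto _).comp h1).const_smul α |>.prodMk_nhds h2)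
    exact huniq (hS.mem_of_tendsto hlim (Filter.Eventually.of_forall fun n => hf (s n))) (hf u)
  let gL : U →L[ℂ] V × Y := ⟨g, hg⟩
  exact ⟨(ContinuousLinearMap.fst ℂ V Y).comp gL, (ContinuousLinearMap.snd ℂ V Y).comp gL, hf⟩

/-- The operator `C (α J - A)⁻¹` is bounded. -/
theorem exists_outResolvent [CompleteSpace X] [CompleteSpace Y]
    (hS : S.IsClosed) (h : IsResolvent J (mainOp S) α T) :
    ∃ Q : X →L[ℂ] Y, ∀ x, ((T x, 0), (α • J (T x) - x, Q x)) ∈ S.graph := by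
  have huniq : ∀ {x : X} {y y' : Y}, ((T x, 0), (α • J (T x) - x, y)) ∈ S.graph →
      ((T x, 0), (α • J (T x) - x, y')) ∈ S.graph → y = y' := fun hy hy' =>
    congrArg Prod.snd (S.mem_graph_snd_inj hy hy' rfl)
  have hex : ∀ x : X, ∃ y : Y, ((T x, 0), (α • J (T x) - x, y)) ∈ S.graph := fun x =>
    mem_graph_mainOp.1 (h.mem_graph x)
  choose f hf using hex
  let g : X →ₗ[ℂ] Y :=
    { toFun := f
      map_add' := fun u u' => huniq (hf _) (by
        convert S.graph.add_mem (hf u) (hf u') using 1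
        simp only [Prod.mk_add_mk, map_add, smul_add, zero_add, Prod.mk.injEq, true_and, and_true]
        abel)
      map_smul' := fun c u => huniq (hf _) (by
        simpa [smul_comm c α, smul_sub] using S.graph.smul_mem c (hf u)) }
  have hg : Continuous g := by
    refine g.continuous_of_seq_closed_graph fun s x y hs hp => ?_
    have hlim : Filter.Tendsto
        (fun n => ((T (s n), (0 : U)), (α • J (T (s n)) - s n, g (s n))))
        Filter.atTop (nhds ((T x, (0 : U)), (α • J (T x) - x, y))) := by
      have h1 : Filter.Tendsto (fun n => ((T (s n), (0 : U)), α • J (T (s n)) - s n)) Filter.atTop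
          (nhds ((T x, (0 : U)), α • J (T x) - x)) :=
        ((by fun_prop : Continuous fun z : X =>
          ((T z, (0 : U)), α • J (T z) - z)).tendsto x).comp hs
      exact ((continuous_fst.tendsto _).comp h1).prodMk_nhds
        (((continuous_snd.tendsto _).comp h1).prodMk_nhds hp)
    exact huniq (hS.mem_of_tendsto hlim (Filter.Eventually.of_forall fun n => hf (s n))) (hf x)
  exact ⟨⟨g, hg⟩, hf⟩

/-- With `W` the solution map at `β`, `(v - W u, x - βJ(W u))` lies in the graph of the main
operator. Applying the resolvent gives `(βJ - A)⁻¹x = β(βJ - A)⁻¹Jv - v + W u`, a bounded function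
of `(v, u)`. -/
theorem extrapRow_apply [CompleteSpace V] [CompleteSpace U] [CompleteSpace Y]
    (hS : S.IsClosed) (hU : ∀ u, ∃ v, (v, u) ∈ S.domain)
    (hd : Dense ((mainOp S).domain : Set V)) (h : IsResolvent J (mainOp S) β T)
    {v : V} {u : U} {x : X} {y : Y} (hm : ((v, u), (x, y)) ∈ S.graph) :
    extrapRow J S β (v, u) = toExtrap J (mainOp S) β x := by
  obtain ⟨w, hw, hw'⟩ := (LinearPMap.mem_graph_iff _).1 hm
  have h1 : topRow S w = x := congrArg Prod.fst hw'
  have hw : (w : V × U) = (v, u) := hw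
  rw [← hw, ← h1]
  refine LinearMap.extendOfNorm_eq
    (f := (toExtrap J (mainOp S) β).toLinearMap.comp (topRow S).toFun)
    (denseRange_subtype_domain (dense_domain_of_mainOp hU hd)) ?_ w
  set T₀ := DissNode.boundedInverse (pencil J (mainOp S) β) with hT₀
  have h₀ : IsResolvent J (mainOp S) β T₀ := h.boundedInverse
  obtain ⟨W, D, hWD⟩ := exists_controlResolvent hS hU h
  let L : V × U →L[ℂ] V :=
    (β • (T₀.comp (J : V →L[ℂ] X)) - ContinuousLinearMap.id ℂ V).comp
      (ContinuousLinearMap.fst ℂ V U) + W.comp (ContinuousLinearMap.snd ℂ V U)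
  refine ⟨‖L‖, fun w => ?_⟩
  change ‖toExtrap J (mainOp S) β (topRow S w)‖ ≤ ‖L‖ * ‖(w : V × U)‖
  rw [norm_toExtrap, ← hT₀]
  have h2 : T₀ (topRow S w) = L w := by
    have h3 : (((w : V × U).1, (w : V × U).2), ((S w).1, (S w).2)) ∈ S.graph := S.mem_graph w
    have h4 := (h₀ _ _).1 (mainOp_sub_mem h3 (hWD _))
    change T₀ (S w).1 = β • T₀ (J (w : V × U).1) - (w : V × U).1 + W (w : V × U).2
    have h5 : β • J ((w : V × U).1 - W (w : V × U).2) - ((S w).1 - β • J (W (w : V × U).2)) =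
        β • J (w : V × U).1 - (S w).1 := by
      rw [map_sub]
      module
    rw [h5, map_sub, map_smul] at h4
    rw [sub_add, ← h4]
    abel
  rw [h2]
  exact L.le_opNorm _

theorem extrapRow_inl [CompleteSpace V] [CompleteSpace U] [CompleteSpace Y]
    (hS : S.IsClosed) (hU : ∀ u, ∃ v, (v, u) ∈ S.domain)
    (hd : Dense ((mainOp S).domain : Set V)) (h : IsResolvent J (mainOp S) β T) (v : V) :
    extrapRow J S β (v, 0) = extrapOp J (mainOp S) β v := by
  revert v
  refine (denseRange_subtype_domain hd).induction ?_ (isClosed_eq (by fun_prop) (by fun_prop))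
  rintro _ ⟨w, rfl⟩
  obtain ⟨y, hy⟩ := mem_graph_mainOp.1 ((mainOp S).mem_graph w)
  exact (extrapRow_apply hS hU hd h hy).trans (extrapOp_apply hd h ((mainOp S).mem_graph w)).symm

/-- Rewrites `A&B (v, u) = αJv` as `Bu = (αJ - A₋₁)v`, so that solutions over `u` are `(αJ -
A₋₁)⁻¹Bu`. Here `α` is arbitrary. -/
theorem controlOp_eq [CompleteSpace V] [CompleteSpace U] [CompleteSpace Y]
    (hS : S.IsClosed) (hU : ∀ u, ∃ v, (v, u) ∈ S.domain)
    (hd : Dense ((mainOp S).domain : Set V)) (h : IsResolvent J (mainOp S) β T)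
    {v : V} {u : U} {y : Y} (hm : ((v, u), (α • J v, y)) ∈ S.graph) :
    controlOp J S β u = α • toExtrap J (mainOp S) β (J v) - extrapOp J (mainOp S) β v := by
  rw [← extrapRow_inl hS hU hd h, ← map_smul, ← extrapRow_apply hS hU hd h hm, ← map_sub]
  simp [controlOp]

/-- The vector `(αI - A₋₁)⁻¹Bu` is the solution over `u`, so `(v, u)` is in the domain and the
bounded map of `exists_controlResolvent` shows that the default value `0` in the definition is not
used. -/
theorem transferFunction_eq {S : X × U →ₗ.[ℂ] X × Y} {T T' : X →L[ℂ] X}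
    [CompleteSpace X] [CompleteSpace U] [CompleteSpace Y]
    (hS : S.IsClosed) (hU : ∀ u, ∃ v, (v, u) ∈ S.domain)
    (hd : Dense ((mainOp S).domain : Set X))
    (h : IsResolvent (ContinuousLinearEquiv.refl ℂ X) (mainOp S) β T)
    (h' : IsResolvent (ContinuousLinearEquiv.refl ℂ X) (mainOp S) α T')
    {v : X} {u : U} {y : Y} (hm : ((v, u), (α • v, y)) ∈ S.graph) :
    transferFunction S β α u = y := by
  have key : ∀ {v : X} {u : U} {y : Y}, ((v, u), (α • v, y)) ∈ S.graph →
      extrapResolvent (ContinuousLinearEquiv.refl ℂ X) (mainOp S) β α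
        (controlOp (ContinuousLinearEquiv.refl ℂ X) S β u) = v := by
    intro v u y hm
    rw [controlOp_eq (J := ContinuousLinearEquiv.refl ℂ X) (α := α) hS hU hd h hm]
    exact (extrapResolvent_spec hd h' h).2.1 v
  have hex : ∃ D : U →L[ℂ] Y, ∀ u, ∃ hu :
      (extrapResolvent (ContinuousLinearEquiv.refl ℂ X) (mainOp S) β α
        (controlOp (ContinuousLinearEquiv.refl ℂ X) S β u), u) ∈ (bottomRow S).domain,
      D u = bottomRow S ⟨_, hu⟩ := by
    obtain ⟨W, D, hWD⟩ := exists_controlResolvent hS hU h'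
    refine ⟨D, fun u => ?_⟩
    have h1 := hWD u
    rw [← key h1] at h1
    obtain ⟨⟨w, hw⟩, h2, h3⟩ := (LinearPMap.mem_graph_iff _).1 (mem_graph_bottomRow.2 ⟨_, h1⟩)
    subst h2
    exact ⟨hw, h3.symm⟩
  obtain ⟨hu, hu'⟩ := hex.choose_spec u
  have h1 : transferFunction S β α = hex.choose := dif_pos hex
  rw [h1, hu']
  refine (bottomRow S).mem_graph_snd_inj ((bottomRow S).mem_graph ⟨_, hu⟩)
    (mem_graph_bottomRow.2 ⟨_, hm⟩) ?_
  exact Prod.ext (key hm) rfl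

end OperatorNode

end Graphs

/-! ### Duality pairings on the product spaces -/

section Duality

variable {X U : Type*} [NormedAddCommGroup X] [InnerProductSpace ℂ X]
  [NormedAddCommGroup U] [InnerProductSpace ℂ U]

theorem codomainDual_apply (x : X) (z : AntiDual U) (p : AntiDual X) (q : U) :
    codomainDual X U (x, z) (p, q) = conj (p x) + z q := by
  simp [codomainDual, prodDual, bidual_apply]

theorem domainDual_apply (x : X) (z : AntiDual U) (p : AntiDual X) (q : U) :
    domainDual X U (p, q) (x, z) = p x + conj (z q) := by
  simp [domainDual, prodDual, bidual_apply]

theorem exists_adjoint (Q : X →L[ℂ] AntiDual U) :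
    ∃ Q' : U →L[ℂ] AntiDual X, ∀ u x, Q' u x = conj (Q x u) := by
  let g : U →ₗ[ℂ] AntiDual X :=
    { toFun := fun u => conjFunctional (Q.flip u)
      map_add' := fun u u' => by ext x; simp [conjFunctional]
      map_smul' := fun c u => by ext x; simp [conjFunctional] }
  have hg : ∀ u x, g u x = conj (Q x u) := fun u x => by simp [g, conjFunctional]
  refine ⟨g.mkContinuous ‖Q‖ fun u => ?_, hg⟩
  refine ContinuousLinearMap.opNorm_le_bound _ (by positivity) fun x => ?_
  rw [hg, RCLike.norm_conj]
  calc ‖Q x u‖ ≤ ‖Q‖ * ‖x‖ * ‖u‖ := Q.le_opNorm₂ x u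
    _ = _ := by ring

end Duality

/-! ### The inverse Riesz map and resolvents on the anti-dual -/

section Riesz

variable {X : Type*} [NormedAddCommGroup X] [InnerProductSpace ℂ X] [CompleteSpace X]

theorem inner_rieszInv (p : AntiDual X) (x : X) : inner ℂ x (rieszInv X p) = p x := by
  have h : riesz X (rieszInv X p) = p := (riesz X).apply_symm_apply p
  rw [← riesz_apply, h]

theorem apply_rieszInv_symm (p w : AntiDual X) : w (rieszInv X p) = conj (p (rieszInv X w)) := by
  rw [← inner_rieszInv, ← inner_rieszInv, inner_conj_symm]

theorem norm_rieszInv (p : AntiDual X) : ‖rieszInv X p‖ = ‖p‖ := (riesz X).symm.norm_map p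

theorem apply_rieszInv_self (p : AntiDual X) : p (rieszInv X p) = ((‖p‖ ^ 2 : ℝ) : ℂ) := by
  rw [← inner_rieszInv, inner_self_eq_norm_sq_to_K, norm_rieszInv]
  push_cast
  rfl

theorem eq_zero_of_forall_apply_eq_zero {x : X} (h : ∀ p : AntiDual X, p x = 0) : x = 0 := by
  have := h (riesz X x)
  rwa [riesz_apply, inner_self_eq_zero] at this

theorem mem_graph_compRiesz {F : AntiDual X →ₗ.[ℂ] X} {v x : X} :
    (v, x) ∈ (compRiesz F).graph ↔ (riesz X v, x) ∈ F.graph := mem_graph_precomp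

theorem IsResolvent.compRiesz {F : AntiDual X →ₗ.[ℂ] X} {α : ℂ} {T : X →L[ℂ] AntiDual X}
    (h : IsResolvent (rieszInv X) F α T) :
    IsResolvent (ContinuousLinearEquiv.refl ℂ X) (compRiesz F) α
      ((rieszInv X : AntiDual X →L[ℂ] X).comp T) := by
  intro v x
  rw [mem_graph_compRiesz, h]
  have h1 : rieszInv X (riesz X v) = v := (riesz X).symm_apply_apply v
  rw [h1]
  exact ((riesz X).symm_apply_eq (x := T (α • v - x)) (y := v)).symm

theorem mem_resolventSet_compRiesz {F : AntiDual X →ₗ.[ℂ] X} {α : ℂ} :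
    α ∈ resolventSet (compRiesz F) ↔ ∃ T, IsResolvent (rieszInv X) F α T := by
  rw [mem_resolventSet_iff]
  constructor
  · rintro ⟨T, h⟩
    refine ⟨((riesz X).toContinuousLinearEquiv : X →L[ℂ] AntiDual X).comp T, fun p x => ?_⟩
    have h1 : riesz X (rieszInv X p) = p := (riesz X).apply_symm_apply p
    have h2 := h (rieszInv X p) x
    rw [mem_graph_compRiesz, h1] at h2
    rw [h2]
    exact ⟨fun e => (congrArg (riesz X) e).trans h1, fun e =>
      ((riesz X).symm_apply_apply (T (α • rieszInv X p - x))).symm.trans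
        (congrArg (riesz X).symm e)⟩
  · rintro ⟨T, h⟩
    exact ⟨_, h.compRiesz⟩

/-! ### Dissipative operators from the anti-dual -/

section Dissipative

variable {F : AntiDual X →ₗ.[ℂ] X} {l m : ℂ} {T : X →L[ℂ] AntiDual X}

/-- Pair `lJp - x` with `p`: the real part is `Re l ‖p‖² - Re ⟨p, x⟩ ≥ Re l ‖p‖²`, and it is at most
`‖p‖ ‖lJp - x‖`. -/
theorem re_mul_norm_le (hF : ∀ p x, (p, x) ∈ F.graph → (p x).re ≤ 0) {p : AntiDual X} {x : X}
    (hp : (p, x) ∈ F.graph) : l.re * ‖p‖ ≤ ‖l • rieszInv X p - x‖ := by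
  have h1 : p (l • rieszInv X p - x) = conj l * ((‖p‖ ^ 2 : ℝ) : ℂ) - p x := by
    rw [map_sub, ContinuousLinearMap.map_smulₛₗ, apply_rieszInv_self]
    rfl
  have h2 : (p (l • rieszInv X p - x)).re = l.re * ‖p‖ ^ 2 - (p x).re := by
    rw [h1, Complex.sub_re, Complex.re_mul_ofReal, Complex.conj_re]
  have h3 := (Complex.re_le_norm _).trans (p.le_opNorm (l • rieszInv X p - x))
  have h4 := hF p x hp
  rcases (norm_nonneg p).eq_or_lt with h0 | h0
  · rw [← h0, mul_zero]
    exact norm_nonneg _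
  · refine le_of_mul_le_mul_left ?_ h0
    nlinarith

theorem exists_isResolvent_of_surjective (hF : ∀ p x, (p, x) ∈ F.graph → (p x).re ≤ 0)
    (hl : 0 < l.re) (hs : ∀ y, ∃ p, (p, l • rieszInv X p - y) ∈ F.graph) :
    ∃ T, IsResolvent (rieszInv X) F l T := by
  have huniq : ∀ {y : X} {p p' : AntiDual X}, (p, l • rieszInv X p - y) ∈ F.graph →
      (p', l • rieszInv X p' - y) ∈ F.graph → p = p' := by
    intro y p p' hp hp'
    have h1 := re_mul_norm_le (l := l) hF (F.graph.sub_mem hp hp')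
    have h2 : l • rieszInv X (p - p') -
        (l • rieszInv X p - y - (l • rieszInv X p' - y)) = 0 := by
      rw [map_sub]
      module
    simp only [] at h1
    rw [h2, norm_zero] at h1
    have h3 : ‖p - p'‖ ≤ 0 := by
      by_contra h
      exact absurd h1 (not_le.2 (mul_pos hl (not_le.1 h)))
    exact sub_eq_zero.1 (norm_le_zero_iff.1 h3)
  choose f hf using hs
  let g : X →ₗ[ℂ] AntiDual X :=
    { toFun := f
      map_add' := fun y y' => huniq (hf _) (by
        convert F.graph.add_mem (hf y) (hf y') using 1
        simp only [Prod.mk_add_mk, map_add, Prod.mk.injEq, true_and]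
        module)
      map_smul' := fun c y => huniq (hf _) (by
        convert F.graph.smul_mem c (hf y) using 1
        simp only [Prod.smul_mk, map_smul, RingHom.id_apply, Prod.mk.injEq, true_and]
        module) }
  refine ⟨g.mkContinuous l.re⁻¹ fun y => ?_, fun p x => ⟨fun hp => ?_, fun hp => ?_⟩⟩
  · have h1 := re_mul_norm_le (l := l) hF (hf y)
    rw [sub_sub_cancel] at h1
    rwa [inv_mul_eq_div, le_div_iff₀ hl, mul_comm]
  · refine huniq (hf _) ?_
    rwa [sub_sub_cancel]
  · have h1 := hf (l • rieszInv X p - x)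
    have hp : f (l • rieszInv X p - x) = p := hp
    rwa [hp, sub_sub_cancel] at h1

/-- By the lower bound `re_mul_norm_le`, preimages of a convergent sequence are Cauchy; closedness
of `F` then makes the range closed, hence everything. -/
theorem exists_isResolvent_of_denseRange (hc : F.IsClosed)
    (hF : ∀ p x, (p, x) ∈ F.graph → (p x).re ≤ 0) (hl : 0 < l.re)
    (hd : DenseRange (pencil (rieszInv X) F l)) : ∃ T, IsResolvent (rieszInv X) F l T := by
  refine exists_isResolvent_of_surjective hF hl fun y => ?_
  obtain ⟨f, hf, hlim⟩ := mem_closure_iff_seq_limit.1 (hd y)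
  choose w hw using hf
  have hgr : ∀ n, ((w n : AntiDual X), l • rieszInv X (w n : AntiDual X) - f n) ∈ F.graph :=
    fun n =>
    mem_graph_pencil.1 (hw n ▸ (pencil (rieszInv X) F l).mem_graph (w n))
  have hbound : ∀ n k, ‖(w n : AntiDual X) - w k‖ ≤ l.re⁻¹ * ‖f n - f k‖ := by
    intro n k
    have h1 := re_mul_norm_le (l := l) hF (F.graph.sub_mem (hgr n) (hgr k))
    have h2 : l • rieszInv X ((w n : AntiDual X) - w k) -
        (l • rieszInv X (w n : AntiDual X) - f n - (l • rieszInv X (w k : AntiDual X) - f k)) =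
          f n - f k := by
      rw [map_sub]
      module
    rw [inv_mul_eq_div, le_div_iff₀ hl, mul_comm, ← h2]
    exact h1
  have hcauchy : CauchySeq fun n => (w n : AntiDual X) := by
    have h1 := Metric.cauchySeq_iff.1 hlim.cauchySeq
    refine Metric.cauchySeq_iff.2 fun ε hε => ?_
    obtain ⟨N, hN⟩ := h1 (l.re * ε) (by positivity)
    refine ⟨N, fun n hn k hk => ?_⟩
    have h2 := hN n hn k hk
    rw [dist_eq_norm] at h2 ⊢
    refine (hbound n k).trans_lt ?_
    rwa [inv_mul_lt_iff₀ hl]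
  obtain ⟨p, hp⟩ := cauchySeq_tendsto_of_complete hcauchy
  refine ⟨p, hc.mem_of_tendsto (hp.prodMk_nhds ?_) (Filter.Eventually.of_forall hgr)⟩
  exact ((((rieszInv X).continuous.tendsto p).comp hp).const_smul l).sub hlim

theorem IsResolvent.re_mul_sq_le (hF : ∀ p x, (p, x) ∈ F.graph → (p x).re ≤ 0)
    (h : IsResolvent (rieszInv X) F l T) (y : X) : l.re * ‖T y‖ ^ 2 ≤ (T y y).re := by
  have h1 := hF _ _ (h.mem_graph y)
  rw [map_sub, ContinuousLinearMap.map_smulₛₗ, apply_rieszInv_self, smul_eq_mul, Complex.sub_re,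
    Complex.re_mul_ofReal, Complex.conj_re] at h1
  linarith

/-- If `y` is orthogonal to `dom FR`, testing with `J(Ty)` gives `⟨Ty, y⟩ = 0`. Since `Re ⟨Ty, y⟩ ≥
Re l ‖Ty‖²`, it follows that `Ty = 0`, and then `y = 0`. -/
theorem dense_domain_of_isResolvent (hF : ∀ p x, (p, x) ∈ F.graph → (p x).re ≤ 0)
    (hl : 0 < l.re) (h : IsResolvent (rieszInv X) F l T) :
    Dense (F.domain : Set (AntiDual X)) := by
  have h1 : Dense ((compRiesz F).domain : Set X) := by
    rw [Submodule.dense_iff_topologicalClosure_eq_top, Submodule.topologicalClosure_eq_top_iff,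
      Submodule.eq_bot_iff]
    intro y hy
    have hmem : rieszInv X (T y) ∈ (compRiesz F).domain := by
      have h1 : riesz X (rieszInv X (T y)) = T y := (riesz X).apply_symm_apply _
      refine LinearPMap.mem_domain_of_mem_graph (y := l • rieszInv X (T y) - y)
        (mem_graph_compRiesz.2 ?_)
      rw [h1]
      exact h.mem_graph y
    have h2 := Submodule.inner_left_of_mem_orthogonal hmem hy
    rw [inner_rieszInv] at h2
    have h3 := h.re_mul_sq_le hF y
    rw [h2, Complex.zero_re] at h3
    have h4 : T y = 0 := by
      have : ‖T y‖ ^ 2 ≤ 0 := nonpos_of_mul_nonpos_right h3 hl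
      exact norm_eq_zero.1 (pow_eq_zero_iff two_ne_zero |>.1 (le_antisymm this (by positivity)))
    have h5 := h.mem_graph y
    rw [h4, map_zero, smul_zero, zero_sub] at h5
    exact neg_eq_zero.1 (F.graph_fst_eq_zero_snd h5 rfl)
  have h2 := (riesz X).surjective.denseRange.dense_image (riesz X).continuous h1
  refine h2.mono ?_
  rintro _ ⟨x, hx, rfl⟩
  exact hx

/-- The resolvent set of a maximal dissipative operator contains the right half-plane. -/
theorem IsResolvent.exists_of_re_pos (hc : F.IsClosed)
    (hF : ∀ p x, (p, x) ∈ F.graph → (p x).re ≤ 0)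
    (hl : 0 < l.re) (h : IsResolvent (rieszInv X) F l T) (hm : 0 < m.re) :
    ∃ T, IsResolvent (rieszInv X) F m T := by
  refine exists_isResolvent_of_denseRange hc hF hm ?_
  have : Dense ((LinearMap.range (pencil (rieszInv X) F m).toFun : Submodule ℂ X) : Set X) := by
    rw [Submodule.dense_iff_topologicalClosure_eq_top, Submodule.topologicalClosure_eq_top_iff,
      Submodule.eq_bot_iff]
    intro y hy
    -- This vector is `(mJ - F)(Ty)`. Orthogonality to it gives `‖y‖² = (l - m)s` with `s = ⟨Ty,
    -- y⟩`.
    have hmem : y + (m - l) • rieszInv X (T y) ∈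
        LinearMap.range (pencil (rieszInv X) F m).toFun := by
      rw [← LinearPMap.graph_map_snd_eq_range]
      refine ⟨(T y, y + (m - l) • rieszInv X (T y)), mem_graph_pencil.2 ?_, rfl⟩
      have h1 : m • rieszInv X (T y) - (y + (m - l) • rieszInv X (T y)) =
          l • rieszInv X (T y) - y := by module
      rw [h1]
      exact h.mem_graph y
    have h2 := Submodule.inner_left_of_mem_orthogonal hmem hy
    rw [inner_add_right, inner_smul_right, inner_rieszInv, inner_self_eq_norm_sq_to_K] at h2
    have h3 := h.re_mul_sq_le hF y
    have h4 : ‖T y y‖ ≤ ‖T y‖ * ‖y‖ := (T y).le_opNorm y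
    set s := T y y
    have h5 : ((‖y‖ ^ 2 : ℝ) : ℂ) = (l - m) * s := by
      have : ((‖y‖ ^ 2 : ℝ) : ℂ) = (RCLike.ofReal ‖y‖ : ℂ) ^ 2 := by push_cast; rfl
      rw [this]
      linear_combination h2
    -- Multiply by the conjugate of `s` and take real parts. Compared with `‖y‖² Re s ≥ Re l |s|²`,
    -- this leaves `Re m |s|² ≤ 0`.
    have h6 : ‖y‖ ^ 2 * s.re = (l.re - m.re) * ‖s‖ ^ 2 := by
      have h7 : ((‖y‖ ^ 2 : ℝ) : ℂ) * conj s = (l - m) * ((‖s‖ ^ 2 : ℝ) : ℂ) := by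
        rw [h5, mul_assoc, Complex.mul_conj, Complex.normSq_eq_norm_sq]
      have h8 := congrArg Complex.re h7
      rwa [Complex.re_ofReal_mul, Complex.re_mul_ofReal, Complex.conj_re, Complex.sub_re] at h8
    have h9 : ‖s‖ ^ 2 ≤ ‖T y‖ ^ 2 * ‖y‖ ^ 2 := by
      rw [← mul_pow]
      gcongr
    have h10 : l.re * ‖s‖ ^ 2 ≤ ‖y‖ ^ 2 * s.re := by
      calc l.re * ‖s‖ ^ 2 ≤ l.re * (‖T y‖ ^ 2 * ‖y‖ ^ 2) := by gcongr
        _ = ‖y‖ ^ 2 * (l.re * ‖T y‖ ^ 2) := by ring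
        _ ≤ _ := by gcongr
    have h11 : ‖s‖ ^ 2 ≤ 0 := by
      refine nonpos_of_mul_nonpos_right ?_ hm
      linarith
    have h12 : s = 0 :=
      norm_eq_zero.1 (pow_eq_zero_iff two_ne_zero |>.1 (le_antisymm h11 (by positivity)))
    rw [h12, mul_zero, Complex.ofReal_eq_zero, pow_eq_zero_iff two_ne_zero, norm_eq_zero] at h5
    exact h5
  exact this

end Dissipative

/-! ### Adjoints -/

theorem mem_graph_opAdjoint {F : AntiDual X →ₗ.[ℂ] X} (hd : Dense (F.domain : Set (AntiDual X)))
    {v : AntiDual X} {x : X} :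
    (v, x) ∈ (opAdjoint F).graph ↔ ∀ p z, (p, z) ∈ F.graph → v z = conj (p x) := by
  have hmem : ∀ {v : AntiDual X} {x : X}, (v, x) ∈ adjointGraph LinearMap.id (bidual X) F ↔
      ∀ p z, (p, z) ∈ F.graph → v z = conj (p x) := by
    intro v x
    constructor
    · intro h p z hp
      obtain ⟨w, rfl, rfl⟩ := (LinearPMap.mem_graph_iff _).1 hp
      exact (h w).trans (bidual_apply _ _)
    · intro h w
      exact (h _ _ (F.mem_graph w)).trans (bidual_apply _ _).symm
  rw [opAdjoint, adjointVia, Submodule.toLinearPMap_graph_eq, hmem]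
  rintro ⟨v, x⟩ hvx hv
  obtain rfl : v = 0 := hv
  have h1 := hmem.1 hvx
  refine eq_zero_of_forall_apply_eq_zero fun p => ?_
  have hcont : Continuous fun p : AntiDual X => p x := by fun_prop
  revert p
  refine (denseRange_subtype_domain hd).induction ?_ (isClosed_eq hcont continuous_const)
  rintro _ ⟨w, rfl⟩
  have h2 := h1 _ _ (F.mem_graph w)
  rw [eq_comm] at h2
  exact (map_eq_zero _).1 h2

/-- The adjoint of the resolvent of `F` at `α` is the resolvent of `F*` at the conjugate point,
because `J` is self-adjoint for the duality pairing. -/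
theorem IsResolvent.exists_opAdjoint {F : AntiDual X →ₗ.[ℂ] X} {α : ℂ} {T : X →L[ℂ] AntiDual X}
    (hd : Dense (F.domain : Set (AntiDual X))) (h : IsResolvent (rieszInv X) F α T) :
    ∃ T', IsResolvent (rieszInv X) (opAdjoint F) (conj α) T' := by
  obtain ⟨T', hT'⟩ := exists_adjoint T
  refine ⟨T', fun v x => ?_⟩
  rw [mem_graph_opAdjoint hd]
  constructor
  · intro hv
    ext y
    have h1 := hv _ _ (h.mem_graph y)
    rw [map_sub, ContinuousLinearMap.map_smulₛₗ, apply_rieszInv_symm, smul_eq_mul] at h1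
    rw [hT', map_sub, ContinuousLinearMap.map_smulₛₗ, smul_eq_mul, map_sub, map_mul,
      Complex.conj_conj]
    linear_combination h1
  · intro hv p z hp
    have h1 := (h _ _).1 hp
    have h2 := hT' (conj α • rieszInv X v - x) (α • rieszInv X p - z)
    rw [hv, h1, map_sub, map_sub, ContinuousLinearMap.map_smulₛₗ, ContinuousLinearMap.map_smulₛₗ,
      apply_rieszInv_symm p v, smul_eq_mul, smul_eq_mul, map_sub, map_mul,
      Complex.conj_conj] at h2
    linear_combination -h2

/-! ### The duality product extended to the extrapolation space -/

section Pairing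

variable {A : AntiDual X →ₗ.[ℂ] X} {β : ℂ} {T : X →L[ℂ] AntiDual X} {p : AntiDual X} {x₀ : X}

/-- The hypothesis `hp` says that `p` lies in the domain of the adjoint of `A`, with value `x₀`.
Putting `v = (βJ - A)⁻¹x`, it expresses `⟨p, x⟩` through `p(Jv)` and `v x₀`, which are controlled by
`‖v‖`, the extrapolation norm of `x`. The lemma serves both `A = F` and, through `F ⊂ F**`, `A =
F*`. -/
theorem extrapPairing_toExtrap (h : IsResolvent (rieszInv X) A β T)
    (hp : ∀ v z, (v, z) ∈ A.graph → p z = conj (v x₀)) (x : X) :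
    extrapPairing A β p (toExtrap (rieszInv X) A β x) = conj (p x) := by
  refine LinearMap.extendOfNorm_eq (denseRange_toExtrap (rieszInv X) A β) ?_ x
  refine ⟨‖β‖ * ‖p‖ + ‖x₀‖, fun x => ?_⟩
  change ‖conj (p x)‖ ≤ _ * ‖toExtrap (rieszInv X) A β x‖
  rw [norm_toExtrap, RCLike.norm_conj]
  have h₀ := h.boundedInverse
  set v := boundedInverse (pencil (rieszInv X) A β) x with hv
  have h1 := hp _ _ (h₀.mem_graph x)
  rw [← hv, map_sub, ContinuousLinearMap.map_smulₛₗ, smul_eq_mul] at h1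
  have h2 : p x = conj β * p (rieszInv X v) - conj (v x₀) := by linear_combination -h1
  have h3 : ‖p (rieszInv X v)‖ ≤ ‖p‖ * ‖v‖ := by
    rw [← norm_rieszInv v]
    exact p.le_opNorm _
  have h4 : ‖v x₀‖ ≤ ‖v‖ * ‖x₀‖ := v.le_opNorm _
  rw [h2]
  refine (norm_sub_le _ _).trans ?_
  rw [norm_mul, RCLike.norm_conj, RCLike.norm_conj]
  nlinarith [mul_le_mul_of_nonneg_left h3 (norm_nonneg β)]

theorem extrapPairing_extrapOp (hd : Dense (A.domain : Set (AntiDual X)))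
    (h : IsResolvent (rieszInv X) A β T)
    (hp : ∀ v z, (v, z) ∈ A.graph → p z = conj (v x₀)) (v : AntiDual X) :
    extrapPairing A β p (extrapOp (rieszInv X) A β v) = v x₀ := by
  have hcont : Continuous fun v : AntiDual X => v x₀ := by fun_prop
  revert v
  refine (denseRange_subtype_domain hd).induction ?_ (isClosed_eq
    ((extrapPairing A β p).continuous.comp (extrapOp (rieszInv X) A β).continuous) hcont)
  rintro _ ⟨w, rfl⟩
  have h1 := extrapOp_apply hd h (A.mem_graph w)
  have h2 := hp _ _ (A.mem_graph w)
  refine (congrArg (extrapPairing A β p) h1).trans ?_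
  rw [extrapPairing_toExtrap h hp, h2, Complex.conj_conj]
  rfl

end Pairing

end Riesz

/-! ### Dissipation nodes and their adjoints -/

section Node

variable {X U : Type*} [NormedAddCommGroup X] [InnerProductSpace ℂ X] [CompleteSpace X]
  [NormedAddCommGroup U] [InnerProductSpace ℂ U]
  {M : AntiDual X × U →ₗ.[ℂ] X × AntiDual U}

/-- Density of `dom M` makes the adjoint relation single-valued, so it is the graph of the operator
extracted from it. -/
theorem mem_graph_nodeAdjoint (hd : Dense (M.domain : Set (AntiDual X × U)))
    {v : AntiDual X} {y : U} {x : X} {z : AntiDual U} :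
    ((v, y), (x, z)) ∈ (nodeAdjoint M).graph ↔
      ∀ p q a b, ((p, q), (a, b)) ∈ M.graph → v a + conj (b y) = conj (p x) + z q := by
  have hmem : ∀ {v : AntiDual X} {y : U} {x : X} {z : AntiDual U},
      ((v, y), (x, z)) ∈ adjointGraph (domainDual X U) (codomainDual X U) M ↔
      ∀ p q a b, ((p, q), (a, b)) ∈ M.graph → v a + conj (b y) = conj (p x) + z q := by
    intro v y x z
    constructor
    · intro h p q a b hm
      obtain ⟨w, hw, hw'⟩ := (LinearPMap.mem_graph_iff _).1 hm
      have h1 := h w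
      rw [hw, hw'] at h1
      rwa [domainDual_apply, codomainDual_apply] at h1
    · intro h w
      exact (domainDual_apply _ _ _ _).trans
        ((h _ _ _ _ (M.mem_graph w)).trans (codomainDual_apply _ _ _ _).symm)
  rw [nodeAdjoint, adjointVia, Submodule.toLinearPMap_graph_eq, hmem]
  rintro ⟨⟨v, y⟩, ⟨x, z⟩⟩ h hv
  obtain ⟨rfl, rfl⟩ : v = 0 ∧ y = 0 := Prod.mk.inj hv
  have h1 := hmem.1 h
  have h2 : ∀ w : AntiDual X × U, codomainDual X U (x, z) w = 0 := by
    refine (denseRange_subtype_domain hd).induction ?_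
      (isClosed_eq (codomainDual X U (x, z)).continuous continuous_const)
    rintro _ ⟨w, rfl⟩
    have h3 := h1 _ _ _ _ (M.mem_graph w)
    refine (codomainDual_apply _ _ _ _).trans (h3.symm.trans ?_)
    simp
  have hx : x = 0 := eq_zero_of_forall_apply_eq_zero fun p => by
    have h3 := h2 (p, 0)
    rw [codomainDual_apply, map_zero, add_zero] at h3
    exact (map_eq_zero _).1 h3
  have hz : z = 0 := by
    ext q
    have h3 := h2 (0, q)
    rw [codomainDual_apply] at h3
    simpa using h3
  exact Prod.ext hx hz

namespace IsDissipationNode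

theorem re_le (hM : IsDissipationNode M) {p : AntiDual X} {q : U} {x : X} {z : AntiDual U}
    (h : ((p, q), (x, z)) ∈ M.graph) : (p x).re + (z q).re ≤ 0 := by
  have h1 := hM.dissipative _ h
  rwa [codomainDual_apply, Complex.add_re, Complex.conj_re] at h1

theorem mainOp_re_le (hM : IsDissipationNode M) (p : AntiDual X) (x : X)
    (h : (p, x) ∈ (mainOp M).graph) : (p x).re ≤ 0 := by
  obtain ⟨z, hz⟩ := mem_graph_mainOp.1 h
  simpa using hM.re_le hz

theorem exists_isResolvent (hM : IsDissipationNode M) {l : ℂ} (hl : 0 < l.re) :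
    ∃ T, IsResolvent (rieszInv X) (mainOp M) l T := by
  obtain ⟨m, hm, hd⟩ := hM.dense_range
  have hc := isClosed_mainOp hM.closed_topRow
  obtain ⟨T, hT⟩ := exists_isResolvent_of_denseRange hc hM.mainOp_re_le hm hd
  exact hT.exists_of_re_pos hc hM.mainOp_re_le hm hl

theorem dense_mainOp_domain (hM : IsDissipationNode M) :
    Dense ((mainOp M).domain : Set (AntiDual X)) := by
  obtain ⟨T, hT⟩ := hM.exists_isResolvent (l := 1) (by simp)
  exact dense_domain_of_isResolvent hM.mainOp_re_le (by simp) hT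

theorem dense_domain (hM : IsDissipationNode M) : Dense (M.domain : Set (AntiDual X × U)) :=
  dense_domain_of_mainOp hM.exists_mem_domain hM.dense_mainOp_domain

theorem isMaximalDissipative (hM : IsDissipationNode M) :
    IsMaximalDissipative (codomainDual X U) M.graph := by
  refine ⟨hM.dissipative, fun Z hZ hMZ => le_antisymm ?_ hMZ⟩
  obtain ⟨T, hT⟩ := hM.exists_isResolvent (l := 1) (by simp)
  rintro ⟨⟨p, q⟩, ⟨x, z⟩⟩ hp
  obtain ⟨p₁, hp₁⟩ := hM.exists_mem_domain q
  obtain ⟨⟨x₁, z₁⟩, h₁⟩ := LinearPMap.mem_domain_iff.1 hp₁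
  -- The argument of the resolvent is chosen so that, after subtracting the corrected element of
  -- `M`, the `X`-component of the difference is `J` of its `X*`-component.
  obtain ⟨z₂, h₂⟩ := mem_graph_mainOp.1 (hT.mem_graph (rieszInv X (p - p₁) - (x - x₁)))
  set t := T (rieszInv X (p - p₁) - (x - x₁))
  have h₃ := M.graph.add_mem h₁ h₂
  have h₄ := Z.sub_mem hp (hMZ h₃)
  have h5 : x - (x₁ + ((1 : ℂ) • rieszInv X t - (rieszInv X (p - p₁) - (x - x₁)))) =
      rieszInv X (p - (p₁ + t)) := by
    simp only [map_sub, map_add, one_smul]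
    abel
  have hw : p - (p₁ + t) = 0 := by
    have h6 := hZ _ h₄
    simp only [Prod.mk_add_mk, Prod.mk_sub_mk, codomainDual_apply, h5, apply_rieszInv_self] at h6
    rw [add_zero, sub_self, map_zero, add_zero, Complex.conj_ofReal, Complex.ofReal_re] at h6
    exact norm_eq_zero.1 (pow_eq_zero_iff two_ne_zero |>.1 (le_antisymm h6 (by positivity)))
  have hx : x - (x₁ + ((1 : ℂ) • rieszInv X t - (rieszInv X (p - p₁) - (x - x₁)))) = 0 := by
    rw [h5, hw, map_zero]
  simp only [Prod.mk_add_mk, Prod.mk_sub_mk, add_zero, sub_self, hw, hx] at h₄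
  have hz : z - (z₁ + z₂) = 0 := by
    ext u
    set v := z - (z₁ + z₂)
    obtain ⟨p₀, hp₀⟩ := hM.exists_mem_domain u
    obtain ⟨⟨x₀, z₀⟩, h₀⟩ := LinearPMap.mem_domain_iff.1 hp₀
    -- Adding multiples of `(0, 0; 0, v)` to an element of `M` over `u` changes the dissipation form
    -- affinely in `r`. Being bounded above for all real `r`, it cannot have slope `‖v u‖² > 0`.
    have h5 : ∀ r : ℝ, (p₀ x₀).re + (z₀ u).re + r * ‖v u‖ ^ 2 ≤ 0 := by
      intro r
      have h6 := hZ _ (Z.add_mem (hMZ h₀) (Z.smul_mem ((r : ℂ) * conj (v u)) h₄))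
      have h7 : (((r : ℂ) * conj (v u)) * v u) = ((r * ‖v u‖ ^ 2 : ℝ) : ℂ) := by
        rw [mul_assoc, Complex.conj_mul']
        push_cast
        rfl
      simp only [Prod.smul_mk, Prod.mk_add_mk, smul_zero, add_zero, codomainDual_apply,
        add_apply, smul_apply, smul_eq_mul, h7,
        Complex.add_re, Complex.conj_re, Complex.ofReal_re] at h6
      rw [zero_apply, mul_zero, Complex.zero_re] at h6
      linarith
    by_contra hne
    have hpos : 0 < ‖v u‖ ^ 2 := by
      have : v u ≠ 0 := hne
      positivity
    -- This `r` makes the left-hand side equal to `1`.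
    have h6 := h5 ((1 - ((p₀ x₀).re + (z₀ u).re)) / ‖v u‖ ^ 2)
    rw [div_mul_cancel₀ _ hpos.ne'] at h6
    linarith
  rw [sub_eq_zero] at hw hx hz
  rw [Prod.mk_add_mk, Prod.mk_add_mk, Prod.mk_add_mk, add_zero, ← hx, ← hw, ← hz] at h₃
  exact h₃

theorem nodeAdjoint_dissipative (hM : IsDissipationNode M) :
    IsDissipative (codomainDual X U) (nodeAdjoint M).graph := by
  intro z hz
  obtain ⟨v, w⟩ := z
  have hrel : ∀ m n, (m, n) ∈ M.graph →
      codomainDual X U w m = conj (codomainDual X U n v) := by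
    rintro ⟨p, q⟩ ⟨a, b⟩ hm
    have h1 := (mem_graph_nodeAdjoint hM.dense_domain).1 hz p q a b hm
    obtain ⟨v₁, v₂⟩ := v
    obtain ⟨w₁, w₂⟩ := w
    rw [codomainDual_apply, codomainDual_apply, map_add, Complex.conj_conj]
    exact h1.symm
  by_contra! hpos
  have hZ : IsDissipative (codomainDual X U) (M.graph ⊔ Submodule.span ℂ {(v, -w)}) := by
    intro z hz
    obtain ⟨⟨m, n⟩, hm, _, hs, rfl⟩ := Submodule.mem_sup.1 hz
    obtain ⟨c, rfl⟩ := Submodule.mem_span_singleton.1 hs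
    have h1 := hrel m n hm
    have h2 := hM.dissipative _ hm
    have h3 : codomainDual X U (n + c • -w) (m + c • v) = codomainDual X U n m +
        (conj c * codomainDual X U n v - c * conj (codomainDual X U n v)) -
          ((‖c‖ ^ 2 : ℝ) : ℂ) * codomainDual X U w v := by
      have h4 : ((‖c‖ ^ 2 : ℝ) : ℂ) = conj c * c := by
        rw [Complex.conj_mul']
        push_cast
        rfl
      rw [h4, ← h1]
      simp only [map_add, map_smul, map_neg, add_apply,
        smul_apply, neg_apply,
        ContinuousLinearMap.map_smulₛₗ, smul_eq_mul]
      ring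
    change (codomainDual X U (n + c • -w) (m + c • v)).re ≤ 0
    -- By the adjoint relation and the sign in `-w`, the cross terms are a number minus its
    -- conjugate.
    have h5 : (conj c * codomainDual X U n v - c * conj (codomainDual X U n v)).re = 0 := by
      simp [Complex.mul_re]
    rw [h3, Complex.sub_re, Complex.add_re, h5, Complex.re_ofReal_mul]
    have h6 : 0 ≤ ‖c‖ ^ 2 * (codomainDual X U w v).re := mul_nonneg (by positivity) hpos.le
    have h7 : (codomainDual X U n m).re ≤ 0 := h2
    linarith
  have hmem : (v, -w) ∈ M.graph := by
    rw [← hM.isMaximalDissipative.2 _ hZ le_sup_left]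
    exact Submodule.mem_sup_right (Submodule.mem_span_singleton_self _)
  have h1 := congrArg Complex.re (hrel _ _ hmem)
  rw [Complex.conj_re, map_neg, neg_apply, Complex.neg_re] at h1
  have h2 : 0 < (codomainDual X U w v).re := hpos
  linarith

theorem isClosed_nodeAdjoint (hM : IsDissipationNode M) : (nodeAdjoint M).IsClosed := by
  have h : ((nodeAdjoint M).graph : Set ((AntiDual X × U) × (X × AntiDual U))) =
      ⋂ (p : AntiDual X) (q : U) (a : X) (b : AntiDual U) (_ : ((p, q), (a, b)) ∈ M.graph),
        {g | g.1.1 a + conj (b g.1.2) = conj (p g.2.1) + g.2.2 q} := by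
    ext ⟨⟨v, y⟩, ⟨x, z⟩⟩
    simp only [SetLike.mem_coe, mem_graph_nodeAdjoint hM.dense_domain, Set.mem_iInter,
      Set.mem_ofPred_eq]
  rw [LinearPMap.IsClosed, h]
  refine isClosed_iInter fun p => isClosed_iInter fun q => isClosed_iInter fun a =>
    isClosed_iInter fun b => isClosed_iInter fun _ => isClosed_eq ?_ ?_
  · exact ((ContinuousLinearMap.apply' ℂ (starRingEnd ℂ) a).continuous.comp
      (by fun_prop)).add (Complex.continuous_conj.comp (b.continuous.comp (by fun_prop)))
  · exact (Complex.continuous_conj.comp (p.continuous.comp (by fun_prop))).add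
      ((ContinuousLinearMap.apply' ℂ (starRingEnd ℂ) q).continuous.comp (by fun_prop))

/-- The functional `w = (ᾱ J - F*₋₁)⁻¹ K* y`, characterized by `⟨w, (α J - F) p⟩ = ⟨y, K p⟩`. -/
theorem exists_outResolvent_adjoint (hM : IsDissipationNode M) {α : ℂ} {T : X →L[ℂ] AntiDual X}
    (hT : IsResolvent (rieszInv X) (mainOp M) α T) :
    ∃ Q : U →L[ℂ] AntiDual X, ∀ y p a b, ((p, 0), (a, b)) ∈ M.graph →
      Q y (α • rieszInv X p - a) = conj (b y) := by
  obtain ⟨Q, hQ⟩ := exists_outResolvent hM.closed hT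
  obtain ⟨Q', hQ'⟩ := exists_adjoint Q
  refine ⟨Q', fun y p a b hp => ?_⟩
  have h1 := hQ (α • rieszInv X p - a)
  rw [(hT _ _).1 (mem_graph_mainOp.2 ⟨b, hp⟩)] at h1
  have h2 := M.mem_graph_snd_inj h1 hp rfl
  have h3 : Q (α • rieszInv X p - a) = b := congrArg Prod.snd h2
  rw [hQ', h3]

theorem apply_eq_conj_apply_of_mem_opAdjoint (hM : IsDissipationNode M) {p : AntiDual X} {a : X}
    (hp : (p, a) ∈ (mainOp M).graph) (v : AntiDual X) (z : X)
    (hv : (v, z) ∈ (opAdjoint (mainOp M)).graph) : p z = conj (v a) := by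
  rw [(mem_graph_opAdjoint hM.dense_mainOp_domain).1 hv p a hp, Complex.conj_conj]

variable [CompleteSpace U]

/-- Membership in the graph of the upper row of the adjoint is tested on the domain of the main
operator. -/
theorem mem_graph_topRow_nodeAdjoint (hM : IsDissipationNode M) {v : AntiDual X} {y : U} {x : X} :
    ((v, y), x) ∈ (topRow (nodeAdjoint M)).graph ↔
      ∀ p a b, ((p, 0), (a, b)) ∈ M.graph → v a + conj (b y) = conj (p x) := by
  rw [mem_graph_topRow]
  simp only [mem_graph_nodeAdjoint hM.dense_domain]
  constructor
  · rintro ⟨z, hz⟩ p a b hp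
    simpa using hz p 0 a b hp
  · intro h
    obtain ⟨T, hT⟩ := hM.exists_isResolvent (l := 1) (by simp)
    obtain ⟨W, D, hWD⟩ := exists_controlResolvent hM.closed hM.exists_mem_domain hT
    -- The only possible lower component: its value at `q` is forced by testing the adjoint relation
    -- on the solution `(W q, q)`. Any other element of `M` over `q` differs from it by one over
    -- `0`, where `h` applies.
    let z : AntiDual U := v.comp ((rieszInv X : AntiDual X →L[ℂ] X).comp W) +
      conjFunctional (D.flip y) - conjFunctional (W.flip x)
    have hz : ∀ q, z q = v (rieszInv X (W q)) + conj (D q y) - conj (W q x) := fun q => by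
      simp [z, conjFunctional]
    refine ⟨z, fun p q a b hp => ?_⟩
    have h1 := M.graph.sub_mem hp (hWD q)
    simp only [Prod.mk_sub_mk, sub_self, one_smul] at h1
    have h2 := h _ _ _ h1
    simp only [map_sub, sub_apply] at h2
    rw [hz]
    linear_combination h2

theorem mainOp_nodeAdjoint (hM : IsDissipationNode M) :
    mainOp (nodeAdjoint M) = opAdjoint (mainOp M) := by
  refine LinearPMap.eq_of_eq_graph ?_
  ext ⟨v, x⟩
  rw [mem_graph_opAdjoint hM.dense_mainOp_domain, mem_graph_mainOp, ← mem_graph_topRow,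
    hM.mem_graph_topRow_nodeAdjoint]
  simp only [mem_graph_mainOp, map_zero, add_zero]
  exact ⟨fun h p z ⟨b, hb⟩ => h p z b hb, fun h p a b hb => h p a ⟨b, hb⟩⟩

theorem isClosed_topRow_nodeAdjoint (hM : IsDissipationNode M) :
    (topRow (nodeAdjoint M)).IsClosed := by
  have h : ((topRow (nodeAdjoint M)).graph : Set ((AntiDual X × U) × X)) =
      ⋂ (p : AntiDual X) (a : X) (b : AntiDual U) (_ : ((p, 0), (a, b)) ∈ M.graph),
        {g | g.1.1 a + conj (b g.1.2) = conj (p g.2)} := by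
    ext ⟨⟨v, y⟩, x⟩
    simp only [SetLike.mem_coe, hM.mem_graph_topRow_nodeAdjoint, Set.mem_iInter,
      Set.mem_ofPred_eq]
  rw [LinearPMap.IsClosed, h]
  refine isClosed_iInter fun p => isClosed_iInter fun a =>
    isClosed_iInter fun b => isClosed_iInter fun _ => isClosed_eq ?_ ?_
  · exact ((ContinuousLinearMap.apply' ℂ (starRingEnd ℂ) a).continuous.comp
      (by fun_prop)).add (Complex.continuous_conj.comp (b.continuous.comp (by fun_prop)))
  · exact Complex.continuous_conj.comp (p.continuous.comp (by fun_prop))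

theorem nodeAdjoint_isDissipationNode (hM : IsDissipationNode M) :
    IsDissipationNode (nodeAdjoint M) where
  closed := hM.isClosed_nodeAdjoint
  dissipative := hM.nodeAdjoint_dissipative
  closed_topRow := hM.isClosed_topRow_nodeAdjoint
  exists_mem_domain u := by
    obtain ⟨T, hT⟩ := hM.exists_isResolvent (l := 1) (by simp)
    obtain ⟨Q, hQ⟩ := hM.exists_outResolvent_adjoint hT
    -- With `Q u = (J - F*₋₁)⁻¹K*u`, the upper row at `(Q u, u)` takes the value `J(Q u)`.
    refine ⟨Q u, LinearPMap.mem_domain_of_mem_graph (f := topRow (nodeAdjoint M))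
      (y := rieszInv X (Q u)) (hM.mem_graph_topRow_nodeAdjoint.2 fun p a b hp => ?_)⟩
    rw [← hQ u p a b hp, one_smul, map_sub, apply_rieszInv_symm p (Q u)]
    ring
  dense_range := by
    obtain ⟨T, hT⟩ := hM.exists_isResolvent (l := 1) (by simp)
    obtain ⟨T', hT'⟩ := hT.exists_opAdjoint hM.dense_mainOp_domain
    refine ⟨conj 1, by simp, ?_⟩
    rw [hM.mainOp_nodeAdjoint]
    refine Function.Surjective.denseRange fun y => ?_
    obtain ⟨h1, h2⟩ := (isResolvent_iff.1 hT').2 y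
    exact ⟨_, h2⟩

/-! ### Block form of the adjoint -/

theorem dense_opAdjoint_domain (hM : IsDissipationNode M) :
    Dense ((opAdjoint (mainOp M)).domain : Set (AntiDual X)) := by
  rw [← hM.mainOp_nodeAdjoint]
  exact hM.nodeAdjoint_isDissipationNode.dense_mainOp_domain

/-- The domain of `F` separates the points of the extrapolation space of `F*`. -/
theorem extrap_ext (hM : IsDissipationNode M) {γ : ℂ} {T' : X →L[ℂ] AntiDual X}
    (hγ : IsResolvent (rieszInv X) (opAdjoint (mainOp M)) γ T')
    {ξ η : Extrap (rieszInv X) (opAdjoint (mainOp M)) γ}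
    (h : ∀ p a, (p, a) ∈ (mainOp M).graph → extrapPairing (opAdjoint (mainOp M)) γ p ξ =
      extrapPairing (opAdjoint (mainOp M)) γ p η) : ξ = η := by
  obtain ⟨T, hT⟩ := hM.exists_isResolvent (l := 1) (by simp)
  obtain ⟨T₁, hT₁⟩ := hT.exists_opAdjoint hM.dense_mainOp_domain
  obtain ⟨-, -, h3⟩ := extrapResolvent_spec hM.dense_opAdjoint_domain hT₁ hγ
  -- The pairing of `ζ` with `p` is `(J - F*₋₁)⁻¹ζ` evaluated at `(J - F)p`. Since `J - F` is onto,
  -- these pairings determine `ζ`.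
  have key : ∀ ζ p a, (p, a) ∈ (mainOp M).graph → extrapPairing (opAdjoint (mainOp M)) γ p ζ =
      extrapResolvent (rieszInv X) (opAdjoint (mainOp M)) γ (conj 1) ζ (rieszInv X p - a) := by
    intro ζ p a hp
    conv_lhs => rw [← h3 ζ]
    rw [map_sub, map_smul, extrapPairing_toExtrap hγ
        (hM.apply_eq_conj_apply_of_mem_opAdjoint hp),
      extrapPairing_extrapOp hM.dense_opAdjoint_domain hγ
        (hM.apply_eq_conj_apply_of_mem_opAdjoint hp),
      map_one, one_smul, ← apply_rieszInv_symm, map_sub]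
  rw [← h3 ξ, ← h3 η]
  have : extrapResolvent (rieszInv X) (opAdjoint (mainOp M)) γ (conj 1) ξ =
      extrapResolvent (rieszInv X) (opAdjoint (mainOp M)) γ (conj 1) η := by
    ext x
    have h4 := hT.mem_graph x
    have h5 := h _ _ h4
    rw [key _ _ _ h4, key _ _ _ h4, one_smul, sub_sub_cancel] at h5
    exact h5
  rw [this]

theorem extrapPairing_outAdjoint (hM : IsDissipationNode M) {γ : ℂ} {T' : X →L[ℂ] AntiDual X}
    (hγ : IsResolvent (rieszInv X) (opAdjoint (mainOp M)) γ T') (y : U)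
    {p : AntiDual X} {a : X} {b : AntiDual U} (hp : ((p, 0), (a, b)) ∈ M.graph) :
    extrapPairing (opAdjoint (mainOp M)) γ p (outAdjoint M γ y) = conj (b y) := by
  have hex : ∃ K : U →L[ℂ] Extrap (rieszInv X) (opAdjoint (mainOp M)) γ,
      ∀ (v : U) (x' : (outOp M).domain),
        extrapPairing (opAdjoint (mainOp M)) γ x' (K v) = conj (outOp M x' v) := by
    obtain ⟨T, hT⟩ := hM.exists_isResolvent (l := 1) (by simp)
    obtain ⟨Q, hQ⟩ := hM.exists_outResolvent_adjoint hT
    -- `K* = (J - F*₋₁)Q` has the defining property, so the default value `0` of `outAdjoint` is not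
    -- used.
    refine ⟨((toExtrap (rieszInv X) (opAdjoint (mainOp M)) γ).comp
      (rieszInv X : AntiDual X →L[ℂ] X) - extrapOp (rieszInv X) (opAdjoint (mainOp M)) γ).comp Q,
      fun v x' => ?_⟩
    obtain ⟨a, ha⟩ := mem_graph_outOp.1 ((outOp M).mem_graph x')
    have hm := mem_graph_mainOp.2 ⟨_, ha⟩
    have h1 := hQ v _ _ _ ha
    rw [one_smul, map_sub] at h1
    change extrapPairing (opAdjoint (mainOp M)) γ x'
      (toExtrap (rieszInv X) (opAdjoint (mainOp M)) γ (rieszInv X (Q v)) -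
        extrapOp (rieszInv X) (opAdjoint (mainOp M)) γ (Q v)) = _
    rw [map_sub, extrapPairing_toExtrap hγ
        (hM.apply_eq_conj_apply_of_mem_opAdjoint hm),
      extrapPairing_extrapOp hM.dense_opAdjoint_domain hγ
        (hM.apply_eq_conj_apply_of_mem_opAdjoint hm),
      ← apply_rieszInv_symm, h1]
  have h1 : outAdjoint M γ = hex.choose := dif_pos hex
  obtain ⟨w, hw, hw'⟩ := (LinearPMap.mem_graph_iff _).1 (mem_graph_outOp.2 ⟨_, hp⟩)
  have h2 := hex.choose_spec y w
  rw [h1]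
  rw [hw, hw'] at h2
  exact h2

/-- Pairing both sides of the extrapolated equation with `p ∈ dom F` gives exactly the test
condition over `0`, and such pairings separate points. -/
theorem mem_graph_topRow_nodeAdjoint_iff (hM : IsDissipationNode M) {γ : ℂ}
    {T' : X →L[ℂ] AntiDual X} (hγ : IsResolvent (rieszInv X) (opAdjoint (mainOp M)) γ T')
    {v : AntiDual X} {y : U} {x : X} :
    ((v, y), x) ∈ (topRow (nodeAdjoint M)).graph ↔
      toExtrap (rieszInv X) (opAdjoint (mainOp M)) γ x =
        extrapOp (rieszInv X) (opAdjoint (mainOp M)) γ v + outAdjoint M γ y := by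
  rw [hM.mem_graph_topRow_nodeAdjoint]
  have key : ∀ p a b, ((p, 0), (a, b)) ∈ M.graph →
      (extrapPairing (opAdjoint (mainOp M)) γ p
        (toExtrap (rieszInv X) (opAdjoint (mainOp M)) γ x) = conj (p x) ∧
      extrapPairing (opAdjoint (mainOp M)) γ p
        (extrapOp (rieszInv X) (opAdjoint (mainOp M)) γ v + outAdjoint M γ y) =
          v a + conj (b y)) := by
    intro p a b hp
    have hm := mem_graph_mainOp.2 ⟨_, hp⟩
    rw [map_add, extrapPairing_toExtrap hγ
        (hM.apply_eq_conj_apply_of_mem_opAdjoint hm),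
      extrapPairing_extrapOp hM.dense_opAdjoint_domain hγ
        (hM.apply_eq_conj_apply_of_mem_opAdjoint hm),
      hM.extrapPairing_outAdjoint hγ y hp]
    exact ⟨rfl, rfl⟩
  constructor
  · intro h
    refine hM.extrap_ext hγ fun p a hp => ?_
    obtain ⟨b, hb⟩ := mem_graph_mainOp.1 hp
    rw [(key p a b hb).1, (key p a b hb).2, h p a b hb]
  · intro h p a b hp
    rw [← (key p a b hp).2, ← h, (key p a b hp).1]

theorem transferFunction_nodeCompRiesz (hM : IsDissipationNode M) {α β : ℂ}
    {T T' : X →L[ℂ] AntiDual X} (hβ : IsResolvent (rieszInv X) (mainOp M) β T)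
    (hα : IsResolvent (rieszInv X) (mainOp M) α T')
    {p : AntiDual X} {q : U} {b : AntiDual U}
    (hp : ((p, q), (α • rieszInv X p, b)) ∈ M.graph) :
    transferFunction (nodeCompRiesz M) β α q = b := by
  have hmem : ∀ {v : X} {u : U} {x : X} {z : AntiDual U},
      ((v, u), (x, z)) ∈ (nodeCompRiesz M).graph ↔ ((riesz X v, u), (x, z)) ∈ M.graph :=
    mem_graph_precomp
  have hmain : mainOp (nodeCompRiesz M) = compRiesz (mainOp M) := by
    refine LinearPMap.eq_of_eq_graph ?_
    ext ⟨v, x⟩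
    rw [mem_graph_mainOp, mem_graph_compRiesz, mem_graph_mainOp]
    simp only [hmem]
  have hinv : ∀ p : AntiDual X, riesz X (rieszInv X p) = p := (riesz X).apply_symm_apply
  have hclosed : (nodeCompRiesz M).IsClosed := by
    have h : ((nodeCompRiesz M).graph : Set ((X × U) × (X × AntiDual U))) =
        (fun g : (X × U) × (X × AntiDual U) => ((riesz X g.1.1, g.1.2), g.2)) ⁻¹' M.graph := by
      ext ⟨⟨v, u⟩, ⟨x, z⟩⟩
      exact hmem
    rw [LinearPMap.IsClosed, h]
    refine IsClosed.preimage ?_ hM.closed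
    exact (((riesz X).continuous.comp (continuous_fst.comp continuous_fst)).prodMk
      (continuous_snd.comp continuous_fst)).prodMk continuous_snd
  have hU : ∀ u, ∃ v, (v, u) ∈ (nodeCompRiesz M).domain := by
    intro u
    obtain ⟨p, hp⟩ := hM.exists_mem_domain u
    refine ⟨rieszInv X p, ?_⟩
    change (riesz X (rieszInv X p), u) ∈ M.domain
    rwa [hinv]
  have hd : Dense ((mainOp (nodeCompRiesz M)).domain : Set X) := by
    rw [hmain]
    refine ((rieszInv X).surjective.denseRange.dense_image (rieszInv X).continuous
      hM.dense_mainOp_domain).mono ?_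
    rintro _ ⟨p, hp, rfl⟩
    change riesz X (rieszInv X p) ∈ (mainOp M).domain
    rwa [hinv]
  refine transferFunction_eq (v := rieszInv X p) hclosed hU hd (hmain ▸ hβ.compRiesz)
    (hmain ▸ hα.compRiesz) (hmem.2 ?_)
  rwa [hinv]

theorem bottomRow_nodeAdjoint_eq (hM : IsDissipationNode M) {α β γ : ℂ}
    {Tα Tβ Tγ : X →L[ℂ] AntiDual X} (hα : IsResolvent (rieszInv X) (mainOp M) α Tα)
    (hβ : IsResolvent (rieszInv X) (mainOp M) β Tβ)
    (hγ : IsResolvent (rieszInv X) (opAdjoint (mainOp M)) γ Tγ)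
    {v : AntiDual X} {y : U} {x : X} {z : AntiDual U}
    (hv : ((v, y), (x, z)) ∈ (nodeAdjoint M).graph) :
    ∃ h : v - extrapResolvent (rieszInv X) (opAdjoint (mainOp M)) γ (conj α)
        (outAdjoint M γ y) ∈ (opAdjoint (mainOp M)).domain,
      z = controlAdjoint M β ⟨_, h⟩ +
        boundedAdjoint (transferFunction (nodeCompRiesz M) β α) y := by
  obtain ⟨T', hT'⟩ := hα.exists_opAdjoint hM.dense_mainOp_domain
  obtain ⟨-, -, h3⟩ := extrapResolvent_spec hM.dense_opAdjoint_domain hT' hγ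
  have h4 := h3 (outAdjoint M γ y)
  set w := extrapResolvent (rieszInv X) (opAdjoint (mainOp M)) γ (conj α) (outAdjoint M γ y)
  have htop := (hM.mem_graph_topRow_nodeAdjoint_iff hγ).1 (mem_graph_topRow.2 ⟨z, hv⟩)
  -- Since `K*y = (ᾱJ - F*₋₁)w`, the value `F*₋₁(v - w) = x - ᾱJw` lies in `X`, which puts `v - w`
  -- in `dom F*`.
  have hgr : (v - w, x - conj α • rieszInv X w) ∈ (opAdjoint (mainOp M)).graph := by
    refine mem_graph_of_extrapOp_eq hM.dense_opAdjoint_domain hγ ?_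
    rw [map_sub, map_sub, map_smul, htop, ← h4]
    abel
  refine ⟨LinearPMap.mem_domain_of_mem_graph hgr, ?_⟩
  ext q
  obtain ⟨W, D, hWD⟩ := exists_controlResolvent hM.closed hM.exists_mem_domain hα
  have h5 := (mem_graph_nodeAdjoint hM.dense_domain).1 hv _ _ _ _ (hWD q)
  have hadj := (mem_graph_opAdjoint hM.dense_mainOp_domain).1 hgr
  have h6 : controlAdjoint M β ⟨v - w, LinearPMap.mem_domain_of_mem_graph hgr⟩ q =
      conj (extrapPairing (mainOp M) β (v - w) (controlOp (rieszInv X) M β q)) := rfl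
  have h7 : boundedAdjoint (transferFunction (nodeCompRiesz M) β α) y q = conj (D q y) := by
    rw [← hM.transferFunction_nodeCompRiesz hβ hα (hWD q)]
    rfl
  rw [add_apply, h6, h7, controlOp_eq hM.closed hM.exists_mem_domain
    hM.dense_mainOp_domain hβ (hWD q), map_sub, map_smul, extrapPairing_toExtrap hβ hadj,
    extrapPairing_extrapOp hM.dense_mainOp_domain hβ hadj]
  simp only [ContinuousLinearMap.map_smulₛₗ, map_sub, sub_apply,
    smul_eq_mul, map_mul, Complex.conj_conj] at h5 ⊢
  -- Symmetry of `J` cancels the two terms containing `w`; what remains is the adjoint relation `h5`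
  -- on the solution over `q`.
  rw [apply_rieszInv_symm (W q) w]
  linear_combination -h5

end IsDissipationNode

end Node

end DissNode

end

/-! ### Assembly of the proposition -/

open DissNode in
theorem mainTheorem4 {X U : Type*}
    [NormedAddCommGroup X] [InnerProductSpace ℂ X] [CompleteSpace X]
    [NormedAddCommGroup U] [InnerProductSpace ℂ U] [CompleteSpace U]
    (M : AntiDual X × U →ₗ.[ℂ] X × AntiDual U) (hM : IsDissipationNode M) :
    -- `M` is maximal dissipative
    IsMaximalDissipative (codomainDual X U) M.graph ∧
    -- the adjoints and the resolvent sets below are meaningful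
    (Dense (M.domain : Set (AntiDual X × U)) ∧ Dense ((mainOp M).domain : Set (AntiDual X)) ∧
      ∀ l : ℂ, 0 < l.re → l ∈ resolventSet (compRiesz (mainOp M)) ∧
        l ∈ resolventSet (compRiesz (opAdjoint (mainOp M)))) ∧
    -- `M*` is a dissipation node
    IsDissipationNode (nodeAdjoint M) ∧
    -- block form of `M*`; `β`, `γ` realize the extrapolation spaces of `F` and of `F*`
    (∀ β ∈ resolventSet (compRiesz (mainOp M)),
      ∀ γ ∈ resolventSet (compRiesz (opAdjoint (mainOp M))),
        (∀ (x' : AntiDual X) (y : U), (x', y) ∈ (nodeAdjoint M).domain ↔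
          ∃ x : X, toExtrap (rieszInv X) (opAdjoint (mainOp M)) γ x =
            extrapOp (rieszInv X) (opAdjoint (mainOp M)) γ x' + outAdjoint M γ y) ∧
        (∀ p : (nodeAdjoint M).domain,
          toExtrap (rieszInv X) (opAdjoint (mainOp M)) γ (topRow (nodeAdjoint M) p) =
            extrapOp (rieszInv X) (opAdjoint (mainOp M)) γ (p : AntiDual X × U).1 +
              outAdjoint M γ (p : AntiDual X × U).2) ∧
        (∀ α ∈ resolventSet (compRiesz (mainOp M)), ∀ p : (nodeAdjoint M).domain,
          ∃ h : (p : AntiDual X × U).1 -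
              extrapResolvent (rieszInv X) (opAdjoint (mainOp M)) γ (starRingEnd ℂ α)
                (outAdjoint M γ (p : AntiDual X × U).2) ∈ (opAdjoint (mainOp M)).domain,
            bottomRow (nodeAdjoint M) p =
              controlAdjoint M β ⟨_, h⟩ +
                boundedAdjoint (transferFunction (nodeCompRiesz M) β α)
                  (p : AntiDual X × U).2)) ∧
    -- the main operator of `M*` is `F*`
    mainOp (nodeAdjoint M) = opAdjoint (mainOp M) := by
  refine ⟨hM.isMaximalDissipative, ⟨hM.dense_domain, hM.dense_mainOp_domain, fun l hl => ?_⟩,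
    hM.nodeAdjoint_isDissipationNode, fun β hβ γ hγ => ?_, hM.mainOp_nodeAdjoint⟩
  · refine ⟨mem_resolventSet_compRiesz.2 (hM.exists_isResolvent hl),
      mem_resolventSet_compRiesz.2 ?_⟩
    rw [← hM.mainOp_nodeAdjoint]
    exact hM.nodeAdjoint_isDissipationNode.exists_isResolvent hl
  · obtain ⟨Tβ, hβ⟩ := mem_resolventSet_compRiesz.1 hβ
    obtain ⟨Tγ, hγ⟩ := mem_resolventSet_compRiesz.1 hγ
    refine ⟨fun x' y => ?_, fun p => ?_, fun α hα p => ?_⟩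
    · simp only [← hM.mem_graph_topRow_nodeAdjoint_iff hγ]
      exact LinearPMap.mem_domain_iff (f := topRow (nodeAdjoint M))
    · exact (hM.mem_graph_topRow_nodeAdjoint_iff hγ).1 ((topRow (nodeAdjoint M)).mem_graph p)
    · obtain ⟨Tα, hα⟩ := mem_resolventSet_compRiesz.1 hα
      exact hM.bottomRow_nodeAdjoint_eq hα hβ hγ ((nodeAdjoint M).mem_graph p)
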